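/- A geometric $(n_k)$ configuration consists of $n$ distinct points and $n$ distinct straight lines in the Euclidean plane such that each line passes through exactly $k$ of the points and each point lies on exactly $k$ of the lines. **Celestial configurations.** Let $m\ge 1$, $h\ge 1$, and let $S$, $T$ be multisets of $h$ integers from the open interval $(0,m/2)$ such that $\sum_{s\in S} s-\sum_{t\in T} t$ is even and $\prod_{s\in S}\cos(\pi s/m)=\prod_{t\in T}\cos(\pi t/m)$; then $m\#S;T$ is called a celestial cohort. Let $s_1,\dots,s_h$ and $t_1,\dots,t_h$ be orderings of $S$ and $T$. For a point $z\neq \mathcal O$, where $\mathcal O=0$ is the centre, let $(v_1)_i=ze^{2\pi \mathrm i\, i/m}$ ($i$ taken modulo $m$), let $(L_j)_i$ be the line joining $(v_j)_i$ and $(v_j)_{i+s_j}$, and let $(v_{j+1})_i$ be the intersection of $(L_j)_i$ and $(L_j)_{i-t_j}$ ($1\le j<h$), that is, $(v_{j+1})_i=\frac{\cos(\pi s_j/m)}{\cos(\pi t_j/m)}\,e^{\pi \mathrm i(s_j-t_j)/m}(v_j)_i$. (By the conditions on $S$ and $T$, the class $v_{h+1}$ obtained in the same way coincides with $v_1$ up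 to a shift of the index.) If the points $(v_j)_i$ and the lines $(L_j)_i$, $1\le j\le h$, form an $((mh)_4)$ configuration, then it is called the celestial configuration $m\#(s_1,t_1;\dots;s_h,t_h)$ started at $z$; we say then that $m\#(s_1,t_1;\dots;s_h,t_h)$ is a celestial configuration (this does not depend on $z$). **Two-copy nesting.** Let $m\#(s_1,t_1;\dots;s_h,t_h)$ and $m\#(s_2,t_1;s_3,t_2;\dots;s_h,t_{h-1};s_1,t_h)$ be celestial configurations. Take the first one, with classes $v^1_j$, $L^1_j$, started at $1$. Choose an integer $d$ such that the circle through $(v^1_3)_d$, $\mathcal O$ and $(v^1_3)_{d-s_2}$ meets the line $(L^1_1)_0$ (the indices of classes are taken modulo $h$, so $v^1_3$ means $v^1_1$ if $h=2$), and choose a point $w$ of intersection. Take the second configuration, started at $(v^2_1)_0=w$. The points and lines of the two copies together form $[m\#S;T]*2'$. We say that the construction *produces an $(n_5)$ configuration* if * for some choice of $d$ and $w$ the points and lines form an $(n_5)$ configuration, and * they do so for every choice of $d$ and $w$ for which there are $n$ distinct points and $n$ distinct lines and no point lies on more than five of the lines. **Statement.** Let $m\#S;T$ be a celestial cohort, with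 $|S|=|T|=h$, such that $S\cap T=\varnothing$ and, if $h$ is odd, all elements of $T$ are equal, while if $h$ is even, $T$ is the union of two multisets of size $h/2$ each of which is constant. Let $s_1,\dots,s_h$ be any ordering of $S$ and $t_1,\dots,t_h$ an alternating ordering of $T$ ($t_{j+2}=t_j$, indices modulo $h$) such that $m\#(s_1,t_1;\dots;s_h,t_h)$ and $m\#(s_2,t_1;\dots;s_h,t_{h-1};s_1,t_h)$ are celestial configurations. Then the construction $[m\#S;T]*2'$ produces a $((2mh)_5)$ configuration. In particular, for $h=3$, $[m\#\{s_1,s_2,s_3\};\{t,t,t\}]*2'$ produces a $((6m)_5)$ configuration, and for $h=4$, $[m\#\{s_1,s_2,s_3,s_4\};\{t_1,t_1,t_2,t_2\}]*2'$ produces an $((8m)_5)$ configuration (under the same hypotheses). Moreover, $9\#(4,3;2,3;1,3)$ and $9\#(2,3;1,3;4,3)$ are celestial configurations, and $\mathcal N'(9)=[9\#\{4,2,1\};\{3,3,3\}]*2'$ produces a $(54_5)$ configuration. -/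

import Mathlib

/-- A geometric `(n_k)` configuration in the Euclidean plane `ℂ`: `n` points and `n` straight lines
such that each line passes through exactly `k` of the points and each point lies on exactly `k` of
the lines. -/
structure IsGeometricConfiguration (n k : ℕ) (P : Set ℂ) (L : Set (AffineSubspace ℝ ℂ)) :
    Prop where
  finite_points : P.Finite
  finite_lines : L.Finite
  card_points : P.ncard = n
  card_lines : L.ncard = n
  isLine : ∀ l ∈ L, Module.finrank ℝ l.direction = 1
  line_incidences : ∀ l ∈ L, {p | p ∈ P ∧ p ∈ l}.ncard = k
  point_incidences : ∀ p ∈ P, {l | l ∈ L ∧ p ∈ l}.ncard = k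

/-- The numbers `cos (π x / m)`. -/
noncomputable def ccos (m x : ℕ) : ℝ := Real.cos (Real.pi * x / m)

/-- The vertex `(v_j)_i` of the celestial construction `m#(s_0, t_0; …; s_{h-1}, t_{h-1})` with
centre `0` and starting vertex `(v_0)_0 = z`. The class `v_0` consists of the vertices of a regular
`m`-gon; `(L_j)_i` is the line through `(v_j)_i` and `(v_j)_{i + s_j}`, and `(v_{j+1})_i` is the
intersection of `(L_j)_i` and `(L_j)_{i - t_j}`, so passing from `v_j` to `v_{j+1}`
multiplies the radius by `cos (π s_j / m) / cos (π t_j / m)` and adds the angle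
`(s_j - t_j) π / m` (see `celestialVertex_succ_mem`). -/
noncomputable def celestialVertex (m : ℕ) {h : ℕ} (s t : Fin h → ℕ) (z : ℂ) (j : Fin h) (i : ℤ) :
    ℂ :=
  z * ((∏ l ∈ Finset.Iio j, ccos m (s l) / ccos m (t l) : ℝ) : ℂ) *
    Complex.exp (((Real.pi * (2 * i + ∑ l ∈ Finset.Iio j, ((s l : ℝ) - t l)) / m : ℝ) : ℂ) *
      Complex.I)

/-- The line `(L_j)_i` of the celestial construction: it joins `(v_j)_i` and `(v_j)_{i + s_j}`. -/
noncomputable def celestialLine (m : ℕ) {h : ℕ} (s t : Fin h → ℕ) (z : ℂ) (j : Fin h) (i : ℤ) :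
    AffineSubspace ℝ ℂ :=
  line[ℝ, celestialVertex m s t z j i, celestialVertex m s t z j (i + s j)]

/-- Let `a`, `b` be the points at polar angles `θ - α`, `θ + α` on a circle with centre `0`. The line
joining them passes through the point at polar angle `θ + β` on the circle whose radius is
`cos α / cos β` times as large. -/
theorem chord_mem_line (c : ℂ) (θ α β : ℝ) (hα : Real.sin α ≠ 0) (hβ : Real.cos β ≠ 0) :
    c * ((Real.cos α / Real.cos β : ℝ) : ℂ) * Complex.exp (((θ + β : ℝ) : ℂ) * Complex.I) ∈
      line[ℝ, c * Complex.exp (((θ - α : ℝ) : ℂ) * Complex.I),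
        c * Complex.exp (((θ + α : ℝ) : ℂ) * Complex.I)] := by
  have hβ' : Complex.cos (β : ℂ) ≠ 0 := by exact_mod_cast hβ
  have hα' : Complex.sin (α : ℂ) ≠ 0 := by exact_mod_cast hα
  have key : c * ((Real.cos α / Real.cos β : ℝ) : ℂ) *
      Complex.exp (((θ + β : ℝ) : ℂ) * Complex.I) =
      AffineMap.lineMap (c * Complex.exp (((θ - α : ℝ) : ℂ) * Complex.I))
        (c * Complex.exp (((θ + α : ℝ) : ℂ) * Complex.I))
        ((1 + Real.cos α / Real.sin α * (Real.sin β / Real.cos β)) / 2 : ℝ) := by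
    rw [AffineMap.lineMap_apply]
    simp only [vsub_eq_sub, vadd_eq_add, Complex.real_smul, Complex.ofReal_add,
      add_mul, sub_eq_add_neg, Complex.exp_add, Complex.exp_mul_I]
    push_cast
    rw [Complex.cos_neg, Complex.sin_neg]
    field_simp
    ring
  rw [key]
  exact AffineMap.lineMap_mem_affineSpan_pair _ _ _

/-- `(v_{j+1})_i` lies on `(L_j)_i` and on `(L_j)_{i - t_j}`. -/
theorem celestialVertex_succ_mem (m : ℕ) {h : ℕ} (s t : Fin h → ℕ) (z : ℂ) (j k : Fin h)
    (hk : (k : ℕ) = j + 1) (hs : 0 < s j ∧ 2 * s j < m) (ht : 2 * t j < m) (i : ℤ) :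
    celestialVertex m s t z k i ∈ celestialLine m s t z j i ∧
      celestialVertex m s t z k i ∈ celestialLine m s t z j (i - t j) := by
  have hm : (0 : ℝ) < m := by exact_mod_cast (by omega : 0 < m)
  have hIio : Finset.Iio k = insert j (Finset.Iio j) := by
    ext x
    simp only [Finset.mem_Iio, Finset.mem_insert, Fin.lt_def, Fin.ext_iff]
    omega
  have hnot : j ∉ Finset.Iio j := by simp
  have hα : Real.sin (Real.pi * s j / m) ≠ 0 := by
    have h1 : (0 : ℝ) < s j := by exact_mod_cast hs.1
    have h2 : (2 : ℝ) * s j < m := by exact_mod_cast hs.2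
    apply ne_of_gt
    apply Real.sin_pos_of_pos_of_lt_pi
    · positivity
    · rw [div_lt_iff₀ hm]
      nlinarith [Real.pi_pos]
  have hβ : Real.cos (Real.pi * t j / m) ≠ 0 := by
    have h2 : (2 : ℝ) * t j < m := by exact_mod_cast ht
    apply ne_of_gt
    apply Real.cos_pos_of_mem_Ioo
    constructor
    · have : 0 ≤ Real.pi * t j / m := by positivity
      linarith [Real.pi_pos]
    · rw [div_lt_iff₀ hm]
      nlinarith [Real.pi_pos]
  have hβ' : Real.cos (-(Real.pi * t j / m)) ≠ 0 := by rwa [Real.cos_neg]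
  unfold celestialLine celestialVertex
  rw [hIio, Finset.prod_insert hnot, Finset.sum_insert hnot]
  generalize (∏ l ∈ Finset.Iio j, ccos m (s l) / ccos m (t l)) = r
  generalize (∑ l ∈ Finset.Iio j, ((s l : ℝ) - t l)) = σ
  constructor
  · have := chord_mem_line (z * (r : ℂ)) (Real.pi * (2 * i + σ + s j) / m) _ _ hα hβ'
    rw [Real.cos_neg] at this
    have e₁ : Real.pi * (2 * i + σ + s j) / m + -(Real.pi * t j / m) =
      Real.pi * (2 * i + (s j - t j + σ)) / m := by ring
    have e₂ : Real.pi * (2 * i + σ + s j) / m - Real.pi * s j / m =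
      Real.pi * (2 * i + σ) / m := by ring
    have e₃ : Real.pi * (2 * i + σ + s j) / m + Real.pi * s j / m =
      Real.pi * (2 * ((i + s j : ℤ) : ℝ) + σ) / m := by push_cast; ring
    rw [e₁, e₂, e₃] at this
    convert this using 2
    rw [mul_assoc z, ← Complex.ofReal_mul, mul_comm r]
    rfl
  · have := chord_mem_line (z * (r : ℂ)) (Real.pi * (2 * (i - t j) + σ + s j) / m) _ _ hα hβ
    have e₁ : Real.pi * (2 * (i - t j) + σ + s j) / m + Real.pi * t j / m =
      Real.pi * (2 * i + (s j - t j + σ)) / m := by ring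
    have e₂ : Real.pi * (2 * (i - t j) + σ + s j) / m - Real.pi * s j / m =
      Real.pi * (2 * ((i - t j : ℤ) : ℝ) + σ) / m := by push_cast; ring
    have e₃ : Real.pi * (2 * (i - t j) + σ + s j) / m + Real.pi * s j / m =
      Real.pi * (2 * ((i - t j + s j : ℤ) : ℝ) + σ) / m := by push_cast; ring
    rw [e₁, e₂, e₃] at this
    convert this using 2
    rw [mul_assoc z, ← Complex.ofReal_mul, mul_comm r]
    rfl

/-- All points of the celestial construction. -/
def celestialPoints (m : ℕ) {h : ℕ} (s t : Fin h → ℕ) (z : ℂ) : Set ℂ :=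
  {p | ∃ (j : Fin h) (i : ℤ), p = celestialVertex m s t z j i}

/-- All lines of the celestial construction. -/
def celestialLines (m : ℕ) {h : ℕ} (s t : Fin h → ℕ) (z : ℂ) : Set (AffineSubspace ℝ ℂ) :=
  {l | ∃ (j : Fin h) (i : ℤ), l = celestialLine m s t z j i}

/-- The conditions on the parameters of a celestial cohort `m#S;T`: they do not depend on
the order of the parameters. The parameters lie strictly between `0` and `m / 2`, the twist
`(∑ S - ∑ T) / 2` is an integer, and the cosine condition holds (so that the last vertex class of
the construction is the first one again). -/
structure IsCelestialCohort (m h : ℕ) (S T : Multiset ℕ) : Prop where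
  card_left : S.card = h
  card_right : T.card = h
  left_range : ∀ x ∈ S, 0 < x ∧ 2 * x < m
  right_range : ∀ x ∈ T, 0 < x ∧ 2 * x < m
  even_sum : Even (S.sum + T.sum)
  cosine : (S.map (ccos m)).prod = (T.map (ccos m)).prod

/-- `m#(s_0, t_0; …; s_{h-1}, t_{h-1})` is a celestial 4-configuration: the parameters satisfy the
conditions of a cohort and the construction, started at `(v_0)_0 = 1`, really gives an
`((mh)_4)` configuration. -/
structure IsCelestialConfiguration (m : ℕ) {h : ℕ} (s t : Fin h → ℕ) : Prop where
  cohort : IsCelestialCohort m h (Finset.univ.val.map s) (Finset.univ.val.map t)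
  configuration : IsGeometricConfiguration (m * h) 4 (celestialPoints m s t 1)
    (celestialLines m s t 1)

/-- The cyclic shift `(s_0, s_1, …, s_{h-1}) ↦ (s_1, …, s_{h-1}, s_0)`. -/
def cyclicShift {h : ℕ} [NeZero h] (s : Fin h → ℕ) : Fin h → ℕ := fun j => s (j + 1)

/-- A choice in the two-copy nesting construction: `w` is an intersection of the line `(L_0)_0` of
the first copy with the circle through `(v_2)_d`, the centre `0` and `(v_2)_{d - s_1}`. Vertex
classes are indexed from `0` and modulo `h`, so `v_2` is the third class (the first, if `h = 2`). -/
def IsNestingChoice (m : ℕ) {h : ℕ} [NeZero h] (s t : Fin h → ℕ) (d : ℤ) (w : ℂ) : Prop :=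
  w ∈ celestialLine m s t 1 0 0 ∧
    EuclideanGeometry.Cospherical
      ({celestialVertex m s t 1 2 d, 0, celestialVertex m s t 1 2 (d - s 1), w} : Set ℂ)

/-- The points of the two-copy nesting: the first copy is `m#(s_0, t_0; …; s_{h-1}, t_{h-1})` started
at `1`, the second one is `m#(s_1, t_0; …; s_{h-1}, t_{h-2}; s_0, t_{h-1})` started at `w`. -/
def nestingPoints (m : ℕ) {h : ℕ} [NeZero h] (s t : Fin h → ℕ) (w : ℂ) : Set ℂ :=
  celestialPoints m s t 1 ∪ celestialPoints m (cyclicShift s) t w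

/-- The lines of the two-copy nesting. -/
def nestingLines (m : ℕ) {h : ℕ} [NeZero h] (s t : Fin h → ℕ) (w : ℂ) :
    Set (AffineSubspace ℝ ℂ) :=
  celestialLines m s t 1 ∪ celestialLines m (cyclicShift s) t w

/-- The two-copy nesting `*2'` of `m#(s_0, t_0; …; s_{h-1}, t_{h-1})` produces an `(n_5)`
configuration: some choice of the index `d` and of the intersection `w` gives one, and so does
every choice for which there are no unintended coincidences, that is, for which
there are `n` distinct points and `n` distinct lines and no point lies on more than five lines. -/
def NestingProduces (n m : ℕ) {h : ℕ} [NeZero h] (s t : Fin h → ℕ) : Prop :=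
  (∃ (d : ℤ) (w : ℂ), IsNestingChoice m s t d w ∧
    IsGeometricConfiguration n 5 (nestingPoints m s t w) (nestingLines m s t w)) ∧
  ∀ (d : ℤ) (w : ℂ), IsNestingChoice m s t d w →
    (nestingPoints m s t w).ncard = n → (nestingLines m s t w).ncard = n →
    (∀ p ∈ nestingPoints m s t w, {l | l ∈ nestingLines m s t w ∧ p ∈ l}.ncard ≤ 5) →
    IsGeometricConfiguration n 5 (nestingPoints m s t w) (nestingLines m s t w)

/-!
After a spiral similarity the second copy is the system of feet of the perpendiculars from the
centre to the lines of the first copy, so each of its points lies on a line of the first copy.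
Inversion turns the circle condition into the incidence of a line of the second copy with a vertex
of the first. In terms of the slope `x` of the starting point this is the quadratic equation
`cos a * cos b * (1 + x ^ 2) + sin ψ * x = cos ψ`, where `a = t₀` and `b = t₁` in units of `π / m`
and `ψ ≡ a + b` modulo `2`; because `t` alternates, one incidence of this kind entails all of them.

Every other incidence or coincidence is a linear relation for `x` over the cyclotomic field `F`, so
none occurs if `i * x ∉ F`. If `i * x ∈ F`, Kronecker's theorem shows that
`exp (i * ψ) * (1 + i * x) / (1 - i * x)` is a root of unity, whence
`2 * cos a * cos b = cos ψ + cos n` for some integer `n`. If this held for all admissible `ψ`, the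
order-reversing pairing `ψ ↔ n` together with Galois conjugation would leave at most one exceptional
`ψ`, and comparing the gaps between consecutive cosines would leave only a few triples `(a, b, m)`.
These contradict the conjugates of `∏ cos s = ∏ cos t`, by which in each embedding some `cos² s` is
at most `|cos a * cos b|`.
-/

open scoped ComplexConjugate IntermediateField

/-- The cosine of `N` units of angle, the unit being `π / m`. -/
noncomputable def zcos (m : ℕ) (N : ℤ) : ℝ := Real.cos (Real.pi * N / m)

/-- The sine of `N` units of angle, the unit being `π / m`. -/
noncomputable def zsin (m : ℕ) (N : ℤ) : ℝ := Real.sin (Real.pi * N / m)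

/-- The rotation by `N` units of angle, the unit being `π / m`. -/
noncomputable def rot (m : ℕ) (N : ℤ) : ℂ :=
  Complex.exp (((Real.pi * N / m : ℝ) : ℂ) * Complex.I)

theorem ccos_eq_zcos (m x : ℕ) : ccos m x = zcos m x := by
  simp [ccos, zcos]

theorem rot_re (m : ℕ) (N : ℤ) : (rot m N).re = zcos m N := Complex.exp_ofReal_mul_I_re _

theorem rot_im (m : ℕ) (N : ℤ) : (rot m N).im = zsin m N := Complex.exp_ofReal_mul_I_im _

theorem norm_rot (m : ℕ) (N : ℤ) : ‖rot m N‖ = 1 := Complex.norm_exp_ofReal_mul_I _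

theorem rot_ne_zero (m : ℕ) (N : ℤ) : rot m N ≠ 0 := Complex.exp_ne_zero _

@[simp]
theorem rot_zero (m : ℕ) : rot m 0 = 1 := by simp [rot]

theorem rot_add (m : ℕ) (M N : ℤ) : rot m (M + N) = rot m M * rot m N := by
  rw [rot, rot, rot, ← Complex.exp_add]
  congr 1
  push_cast
  ring

theorem rot_mul (m : ℕ) (M N : ℤ) : rot m (M * N) = rot m M ^ N := by
  rw [rot, rot, ← Complex.exp_int_mul]
  congr 1
  push_cast
  ring

theorem rot_neg (m : ℕ) (N : ℤ) : rot m (-N) = (rot m N)⁻¹ := by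
  simpa using rot_mul m N (-1)

theorem rot_sub (m : ℕ) (M N : ℤ) : rot m (M - N) = rot m M / rot m N := by
  rw [sub_eq_add_neg, rot_add, rot_neg, div_eq_mul_inv]

theorem conj_rot (m : ℕ) (N : ℤ) : conj (rot m N) = rot m (-N) := by
  rw [rot_neg, Complex.inv_eq_conj (norm_rot m N)]

theorem rot_eq_zpow (m : ℕ) (N : ℤ) : rot m N = rot m 1 ^ N := by
  rw [← rot_mul, one_mul]

theorem two_mul_zcos_eq_rot_add (m : ℕ) (N : ℤ) : (2 * zcos m N : ℂ) = rot m N + rot m (-N) := by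
  rw [← conj_rot, Complex.add_conj, rot_re]
  push_cast
  rfl

theorem zcos_sq_add_zsin_sq (m : ℕ) (N : ℤ) : zcos m N ^ 2 + zsin m N ^ 2 = 1 :=
  Real.cos_sq_add_sin_sq _

theorem zcos_le_one (m : ℕ) (N : ℤ) : zcos m N ≤ 1 := Real.cos_le_one _

theorem zsin_le_one (m : ℕ) (N : ℤ) : zsin m N ≤ 1 := Real.sin_le_one _

@[simp]
theorem zcos_zero (m : ℕ) : zcos m 0 = 1 := by simp [zcos]

@[simp]
theorem zsin_zero (m : ℕ) : zsin m 0 = 0 := by simp [zsin]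

theorem zcos_neg (m : ℕ) (N : ℤ) : zcos m (-N) = zcos m N := by
  simp [zcos, mul_neg, neg_div]

theorem zsin_neg (m : ℕ) (N : ℤ) : zsin m (-N) = -zsin m N := by
  simp [zsin, mul_neg, neg_div]

theorem zcos_two_mul (m : ℕ) (N : ℤ) : zcos m (2 * N) = 2 * zcos m N ^ 2 - 1 := by
  rw [zcos, zcos, ← Real.cos_two_mul]
  congr 1
  push_cast
  ring

theorem two_mul_zcos_mul_zcos (m : ℕ) (M N : ℤ) :
    2 * zcos m M * zcos m N = zcos m (M + N) + zcos m (N - M) := by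
  rw [← zcos_neg m (N - M), zcos, zcos, zcos, zcos, Real.two_mul_cos_mul_cos, add_comm]
  congr 2 <;> push_cast <;> ring

theorem zcos_sub_zcos_add_two (m : ℕ) (N : ℤ) :
    zcos m N - zcos m (N + 2) = 2 * zsin m (N + 1) * zsin m 1 := by
  rw [zsin, zsin, Real.two_mul_sin_mul_sin, zcos, zcos]
  congr 2 <;> push_cast <;> ring

section

variable {m : ℕ} (hm : 0 < m)
include hm

theorem zcos_add_mul (N k : ℤ) : zcos m (N + m * k) = (-1) ^ k * zcos m N := by
  have hm' : (m : ℝ) ≠ 0 := by positivity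
  rw [zcos, zcos, ← Real.cos_add_int_mul_pi]
  congr 1
  push_cast
  field_simp

theorem abs_zcos_add_mul (N k : ℤ) : |zcos m (N + m * k)| = |zcos m N| := by
  rw [zcos_add_mul hm, abs_mul, abs_neg_one_zpow, one_mul]

theorem zcos_sub_self (N : ℤ) : zcos m (m - N) = -zcos m N := by
  simpa [zcos_neg, sub_eq_neg_add] using zcos_add_mul hm (-N) 1

theorem zcos_self : zcos m m = -1 := by
  simpa using zcos_sub_self hm 0

theorem zsin_sub_self (N : ℤ) : zsin m (m - N) = zsin m N := by
  have hm' : (m : ℝ) ≠ 0 := by positivity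
  rw [zsin, zsin, ← Real.sin_pi_sub]
  congr 1
  push_cast
  field_simp
  ring

theorem strictAntiOn_zcos : StrictAntiOn (zcos m) (Set.Icc 0 m) := by
  intro x hx y hy hxy
  have hm' : (0 : ℝ) < m := by positivity
  have hx' : (0 : ℝ) ≤ x := mod_cast hx.1
  have hy' : (y : ℝ) ≤ m := mod_cast hy.2
  refine Real.cos_lt_cos_of_nonneg_of_le_pi (by positivity) ?_ (by gcongr)
  rw [div_le_iff₀ hm']
  gcongr

theorem zcos_pos {N : ℤ} (hN : 0 ≤ N) (hNm : 2 * N < m) : 0 < zcos m N := by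
  have := strictAntiOn_zcos hm (a := N) (b := m - N) ⟨by lia, by lia⟩ ⟨by lia, by lia⟩ (by lia)
  rw [zcos_sub_self hm] at this
  linarith

theorem zcos_nonneg {N : ℤ} (hN : 0 ≤ N) (hNm : 2 * N ≤ m) : 0 ≤ zcos m N := by
  have := (strictAntiOn_zcos hm).antitoneOn (a := N) (b := m - N) ⟨by lia, by lia⟩
    ⟨by lia, by lia⟩ (by lia)
  rw [zcos_sub_self hm] at this
  linarith

theorem zsin_pos {N : ℤ} (hN : 0 < N) (hNm : N < m) : 0 < zsin m N := by
  have hm' : (0 : ℝ) < m := by positivity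
  have : (0 : ℝ) < N := mod_cast hN
  refine Real.sin_pos_of_pos_of_lt_pi (by positivity) ?_
  rw [div_lt_iff₀ hm']
  gcongr
  exact mod_cast hNm

theorem zsin_lt_zsin {M N : ℤ} (hM : 0 ≤ M) (hMN : M < N) (hN : M + N < m) :
    zsin m M < zsin m N := by
  have hm' : (0 : ℝ) < m := by positivity
  wlog h : 2 * N ≤ m generalizing N
  · rw [← zsin_sub_self hm N]
    exact this (by lia) (by lia) (by lia)
  have : (0 : ℝ) ≤ M := mod_cast hM
  have h' : (2 * N : ℝ) ≤ m := mod_cast h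
  refine Real.sin_lt_sin_of_lt_of_le_pi_div_two ?_ ?_ (by gcongr)
  · linarith [show 0 ≤ Real.pi * M / m by positivity, Real.pi_pos]
  · rw [div_le_div_iff₀ hm' two_pos]
    nlinarith [Real.pi_pos]

theorem zcos_eq_of_modEq {M N : ℤ} (h : M ≡ N [ZMOD 2 * m]) : zcos m M = zcos m N := by
  obtain ⟨k, hk⟩ := h.symm.dvd
  rw [show M = N + m * (2 * k) by lia, zcos_add_mul hm, (even_two_mul k).neg_one_zpow, one_mul]

theorem exists_zcos_eq (N : ℤ) : ∃ n ∈ Set.Icc (0 : ℤ) m, 2 ∣ n - N ∧ zcos m n = zcos m N := by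
  have hmod : N % (2 * m) ≡ N [ZMOD 2 * m] := Int.mod_modEq N _
  have hpar : 2 ∣ N % (2 * m) - N := (dvd_mul_right 2 (m : ℤ)).trans (hmod.symm.dvd)
  have h0 := Int.emod_nonneg N (show (2 * m : ℤ) ≠ 0 by lia)
  have h1 := Int.emod_lt_of_pos N (show (0 : ℤ) < 2 * m by lia)
  have hcos := zcos_eq_of_modEq hm hmod
  generalize N % (2 * m) = n at *
  rcases le_total n m with h | h
  · exact ⟨n, ⟨h0, h⟩, hpar, hcos⟩
  · refine ⟨2 * m - n, ⟨by lia, by lia⟩, by lia, ?_⟩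
    rw [← zcos_neg, ← hcos]
    exact zcos_eq_of_modEq hm (Int.modEq_iff_dvd.2 ⟨1, by ring⟩)

theorem zcos_eq_zcos_iff {M N : ℤ} :
    zcos m M = zcos m N ↔ (2 * m : ℤ) ∣ M - N ∨ (2 * m : ℤ) ∣ M + N := by
  have hm' : (m : ℝ) ≠ 0 := by positivity
  constructor
  · rw [zcos, zcos, Real.cos_eq_cos_iff]
    rintro ⟨k, hk | hk⟩ <;> field_simp at hk
    · have hN : (N : ℝ) = 2 * k * m + M := by linear_combination hk
      norm_cast at hN
      exact Or.inl ⟨-k, by rw [hN]; ring⟩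
    · have hN : (N : ℝ) = 2 * k * m - M := by linear_combination hk
      norm_cast at hN
      exact Or.inr ⟨k, by rw [hN]; ring⟩
  · rintro (h | h)
    · exact zcos_eq_of_modEq hm (Int.modEq_iff_dvd.2 h).symm
    · rw [← zcos_neg m N]
      exact zcos_eq_of_modEq hm (Int.modEq_iff_dvd.2 (by rwa [sub_neg_eq_add])).symm

theorem zcos_sq_eq_one_iff {N : ℤ} : zcos m N ^ 2 = 1 ↔ (m : ℤ) ∣ N := by
  have hm' : (m : ℝ) ≠ 0 := by positivity
  have h : zcos m N ^ 2 = 1 ↔ zsin m N = 0 := by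
    rw [← zcos_sq_add_zsin_sq m N, left_eq_add, sq_eq_zero_iff]
  rw [h, zsin, Real.sin_eq_zero_iff]
  constructor
  · rintro ⟨k, hk⟩
    refine ⟨k, ?_⟩
    field_simp at hk
    exact mod_cast (by linarith : (N : ℝ) = m * k)
  · rintro ⟨k, rfl⟩
    refine ⟨k, ?_⟩
    push_cast
    field_simp

end

open Polynomial in
theorem isIntegral_of_isIntegral_add_inv {K : Type*} [Field K] {z : K}
    (h : IsIntegral ℤ (z + z⁻¹)) : IsIntegral ℤ z := by
  rcases eq_or_ne z 0 with rfl | hz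
  · exact isIntegral_zero
  let s : integralClosure ℤ K := ⟨z + z⁻¹, h⟩
  have hs : algebraMap (integralClosure ℤ K) K s = z + z⁻¹ := rfl
  refine isIntegral_trans (A := integralClosure ℤ K) z ⟨X ^ 2 - C s * X + 1, ?_, ?_⟩
  · monicity!
  · simp only [eval₂_add, eval₂_sub, eval₂_mul, eval₂_pow, eval₂_X, eval₂_C, eval₂_one, hs]
    field_simp
    ring

/-- The cyclotomic field generated by the rotations. -/
noncomputable def rotField (m : ℕ) : IntermediateField ℚ ℂ := ℚ⟮rot m 1⟯

theorem rot_mem_rotField (m : ℕ) (N : ℤ) : rot m N ∈ rotField m := by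
  rw [rot_eq_zpow]
  exact zpow_mem (IntermediateField.mem_adjoin_simple_self ℚ _) N

theorem zcos_mem_rotField (m : ℕ) (N : ℤ) : (zcos m N : ℂ) ∈ rotField m := by
  have h := add_mem (rot_mem_rotField m N) (rot_mem_rotField m (-N))
  rw [← two_mul_zcos_eq_rot_add] at h
  simpa using div_mem h (ofNat_mem (rotField m) 2)

section

variable {m : ℕ} (hm : 0 < m)
include hm

theorem isPrimitiveRoot_rot_one : IsPrimitiveRoot (rot m 1) (2 * m) := by
  convert! Complex.isPrimitiveRoot_exp (2 * m) (by lia) using 1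
  rw [rot]
  congr 1
  push_cast
  field_simp

theorem isCyclotomicExtension_rotField : IsCyclotomicExtension {2 * m} ℚ (rotField m) := by
  have : NeZero (2 * m) := ⟨by lia⟩
  have hprim := isPrimitiveRoot_rot_one hm
  have hint : IsIntegral ℚ (rot m 1) := (hprim.isIntegral (by lia)).tower_top
  change IsCyclotomicExtension {2 * m} ℚ ℚ⟮rot m 1⟯.toSubalgebra
  rw [IntermediateField.adjoin_simple_toSubalgebra_of_isAlgebraic hint.isAlgebraic]
  exact hprim.adjoin_isCyclotomicExtension ℚ

theorem exists_rot_eq_of_pow_eq_one {z : ℂ} (hz : z ^ (2 * m) = 1) : ∃ N, z = rot m N := by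
  have : NeZero (2 * m) := ⟨by lia⟩
  obtain ⟨k, -, hk⟩ := (isPrimitiveRoot_rot_one hm).eq_pow_of_pow_eq_one hz
  exact ⟨k, by rw [rot_eq_zpow, zpow_natCast, hk]⟩

theorem exists_algHom_rotField {k : ℕ} (hk : k.Coprime (2 * m)) :
    ∃ σ : rotField m →ₐ[ℚ] ℂ, ∀ N, σ ⟨rot m N, rot_mem_rotField m N⟩ = rot m (k * N) := by
  have : NeZero (2 * m) := ⟨by lia⟩
  have := isCyclotomicExtension_rotField hm
  have hirr := Polynomial.cyclotomic.irreducible_rat (n := 2 * m) (by lia)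
  let ζ : rotField m := ⟨rot m 1, rot_mem_rotField m 1⟩
  have hζ : IsPrimitiveRoot ζ (2 * m) :=
    (isPrimitiveRoot_rot_one hm).of_map_of_injective (f := (rotField m).val)
      (rotField m).val.injective
  have hroot : Polynomial.aeval (rot m k) (minpoly ℚ (hζ.powerBasis ℚ).gen) = 0 := by
    rw [hζ.powerBasis_gen ℚ, ← hζ.minpoly_eq_cyclotomic_of_irreducible hirr, rot_eq_zpow,
      zpow_natCast, Polynomial.aeval_def, Polynomial.eval₂_eq_eval_map, Polynomial.map_cyclotomic]
    exact ((isPrimitiveRoot_rot_one hm).pow_of_coprime k hk).isRoot_cyclotomic (by lia)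
  refine ⟨(hζ.powerBasis ℚ).lift (rot m k) hroot, fun N => ?_⟩
  have hN : (⟨rot m N, rot_mem_rotField m N⟩ : rotField m) = (hζ.powerBasis ℚ).gen ^ N := by
    rw [hζ.powerBasis_gen ℚ]
    exact Subtype.ext ((rot_eq_zpow m N).trans (map_zpow₀ (rotField m).val ζ N).symm)
  rw [hN, map_zpow₀, PowerBasis.lift_gen, ← rot_mul]

theorem aeval_zcos_mul {ι : Type*} {N : ι → ℤ} {P : MvPolynomial ι ℚ}
    (hP : MvPolynomial.aeval (fun i => zcos m (N i)) P = 0) {k : ℕ} (hk : k.Coprime (2 * m)) :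
    MvPolynomial.aeval (fun i => zcos m (k * N i)) P = 0 := by
  obtain ⟨σ, hσ⟩ := exists_algHom_rotField hm hk
  let c : ι → rotField m := fun i => ⟨zcos m (N i), zcos_mem_rotField m (N i)⟩
  have hc (i : ι) : σ (c i) = (zcos m (k * N i) : ℂ) := by
    have h : 2 * c i = ⟨rot m (N i), rot_mem_rotField m _⟩ + ⟨rot m (-N i), rot_mem_rotField m _⟩ :=
      Subtype.ext (two_mul_zcos_eq_rot_add m (N i))
    have h' := congrArg σ h
    rw [map_mul, map_add, hσ, hσ, mul_neg, ← two_mul_zcos_eq_rot_add, map_ofNat] at h'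
    exact mul_left_cancel₀ two_ne_zero h'
  have hzero : MvPolynomial.aeval c P = 0 := Subtype.ext <| by
    have h := congrArg (Complex.ofRealAm.restrictScalars ℚ) hP
    rw [MvPolynomial.comp_aeval_apply, map_zero] at h
    exact (MvPolynomial.comp_aeval_apply c (rotField m).val P).trans h
  have h := congrArg σ hzero
  simp only [MvPolynomial.comp_aeval_apply, hc, map_zero] at h
  have hreal := MvPolynomial.comp_aeval_apply (fun i => zcos m (k * N i))
    (Complex.ofRealAm.restrictScalars ℚ) P
  exact Complex.ofReal_eq_zero.1 (hreal.trans h)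

theorem norm_algHom_eq_one {u : rotField m} (hu : ‖(u : ℂ)‖ = 1) (φ : rotField m →ₐ[ℚ] ℂ) :
    ‖φ u‖ = 1 := by
  have : NeZero (2 * m) := ⟨by lia⟩
  have := isCyclotomicExtension_rotField hm
  have := IsCyclotomicExtension.isGalois {2 * m} ℚ (rotField m)
  let conjC : ℂ →ₐ[ℚ] ℂ := Complex.conjAe.toAlgHom.restrictScalars ℚ
  let conjF : rotField m →ₐ[ℚ] rotField m := conjC.restrictNormal (rotField m)
  have hconj (z : rotField m) : (conjF z : ℂ) = conj (z : ℂ) :=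
    conjC.restrictNormal_commutes (rotField m) z
  have hcomm : φ.comp conjF = conjC.comp φ := by
    refine IntermediateField.adjoin_algHom_ext ℚ fun x hx => ?_
    obtain rfl : x = rot m 1 := hx
    let ζ : rotField m := ⟨rot m 1, rot_mem_rotField m 1⟩
    have hζ : ζ ^ (2 * m) = 1 := Subtype.ext (isPrimitiveRoot_rot_one hm).pow_eq_one
    have hφζ : ‖φ ζ‖ = 1 := Complex.norm_eq_one_of_pow_eq_one (n := 2 * m)
      (by rw [← map_pow, hζ, map_one]) (by lia)
    have hinv : conjF ζ = ζ⁻¹ := Subtype.ext <| (hconj ζ).trans <|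
      ((conj_rot m 1).trans (rot_neg m 1))
    change φ (conjF ζ) = conj (φ ζ)
    rw [hinv, map_inv₀, Complex.inv_eq_conj hφζ]
  have hmul : u * conjF u = 1 := Subtype.ext <| by
    change (u : ℂ) * (conjF u : ℂ) = 1
    rw [hconj, Complex.mul_conj', hu]
    simp
  have hnorm : φ u * conj (φ u) = 1 := by
    rw [← map_one φ, ← hmul, map_mul]
    congr 1
    exact (DFunLike.congr_fun hcomm u).symm
  rw [Complex.mul_conj'] at hnorm
  exact (pow_eq_one_iff_of_nonneg (norm_nonneg _) two_ne_zero).1 (mod_cast hnorm)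

theorem exists_rot_eq_of_isIntegral {u : ℂ} (hu : u ∈ rotField m) (hint : IsIntegral ℤ u)
    (hnorm : ‖u‖ = 1) : ∃ N, u = rot m N := by
  have : NeZero (2 * m) := ⟨by lia⟩
  have := isCyclotomicExtension_rotField hm
  have := IsCyclotomicExtension.numberField {2 * m} ℚ (rotField m)
  let u' : rotField m := ⟨u, hu⟩
  have hint' : IsIntegral ℤ u' :=
    (isIntegral_algHom_iff ((rotField m).val.restrictScalars ℤ) (rotField m).val.injective).1 hint
  obtain ⟨n, hn, hpow⟩ := NumberField.Embeddings.pow_eq_one_of_norm_eq_one (rotField m) ℂ hint'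
    fun φ => norm_algHom_eq_one hm hnorm φ.toRatAlgHom
  have hord : orderOf u' ≠ 0 := (isOfFinOrder_iff_pow_eq_one.2 ⟨n, hn, hpow⟩).orderOf_pos.ne'
  have : NeZero (orderOf u') := ⟨hord⟩
  have hdvd := NumberField.Units.dvd_torsionOrder_of_isPrimitiveRoot (IsPrimitiveRoot.orderOf u')
  rw [IsCyclotomicExtension.Rat.torsionOrder_eq (n := 2 * m), if_pos (even_two_mul m),
    orderOf_dvd_iff_pow_eq_one] at hdvd
  exact exists_rot_eq_of_pow_eq_one hm (congrArg Subtype.val hdvd)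

theorem isIntegral_two_mul_zcos (N : ℤ) : IsIntegral ℤ (2 * zcos m N : ℂ) := by
  have hrot (N : ℤ) : IsIntegral ℤ (rot m N) := by
    refine IsIntegral.of_pow (n := 2 * m) (by lia) ?_
    rw [rot_eq_zpow, ← zpow_natCast, zpow_comm, zpow_natCast,
      (isPrimitiveRoot_rot_one hm).pow_eq_one, one_zpow]
    exact isIntegral_one
  rw [two_mul_zcos_eq_rot_add]
  exact (hrot N).add (hrot (-N))

theorem exists_zcos_add_zcos_eq {A B ψ : ℤ} {x : ℝ} (hx : x * Complex.I ∈ rotField m)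
    (h : (zcos m A + zcos m B) * (1 + x ^ 2) + 2 * zsin m ψ * x = 2 * zcos m ψ) :
    ∃ n, zcos m A + zcos m B = zcos m ψ + zcos m n := by
  -- `x` is the tangent of half the argument of `u / rot m ψ`.
  let u : ℂ := rot m ψ * ((1 + x * Complex.I) / (1 - x * Complex.I))
  have hden : (1 - x * Complex.I : ℂ) ≠ 0 := fun h => by simpa using congrArg Complex.re h
  have hu : u ∈ rotField m := mul_mem (rot_mem_rotField m ψ) <|
    div_mem (add_mem (one_mem _) hx) (sub_mem (one_mem _) hx)
  have hnorm : ‖u‖ = 1 := by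
    have : (1 - x * Complex.I : ℂ) = conj (1 + x * Complex.I) := by simp [sub_eq_add_neg]
    rw [norm_mul, norm_rot, norm_div, one_mul, this, Complex.norm_conj, div_self]
    rwa [← Complex.norm_conj, ← this, norm_ne_zero_iff]
  have hre : u.re = zcos m A + zcos m B - zcos m ψ := by
    have hx2 : (1 + x ^ 2 : ℝ) ≠ 0 := by positivity
    have hquot : (1 + x * Complex.I) / (1 - x * Complex.I) =
        (((1 - x ^ 2) / (1 + x ^ 2) : ℝ) + (2 * x / (1 + x ^ 2) : ℝ) * Complex.I : ℂ) := by
      have hx2' : (1 + x ^ 2 : ℂ) ≠ 0 := mod_cast hx2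
      rw [div_eq_iff hden]
      push_cast
      field_simp
      linear_combination 2 * (x : ℂ) ^ 2 * Complex.I_sq
    simp only [u, hquot, Complex.mul_re, Complex.add_re, Complex.add_im, Complex.ofReal_re,
      Complex.ofReal_im, Complex.mul_im, Complex.I_re, Complex.I_im, rot_re, rot_im]
    field_simp
    linear_combination -h
  have hsum : u + u⁻¹ = 2 * zcos m A + 2 * zcos m B - 2 * zcos m ψ := by
    rw [Complex.inv_eq_conj hnorm, Complex.add_conj, hre]
    push_cast
    ring
  obtain ⟨n, hn⟩ := exists_rot_eq_of_isIntegral hm hu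
    (isIntegral_of_isIntegral_add_inv <| hsum ▸
      ((isIntegral_two_mul_zcos hm A).add (isIntegral_two_mul_zcos hm B)).sub
        (isIntegral_two_mul_zcos hm ψ)) hnorm
  rw [hn, rot_re] at hre
  exact ⟨n, by linarith⟩

end

/-- `t ↦ t ^ 2 - 2` is the map `2 cos θ ↦ 2 cos 2θ`. Two applications of it to the relation
`x + y + z = v` determine the second elementary symmetric function of `x, y, z` and relate the
third one to `v`. -/
theorem mul_add_eq_one_of_add_eq {x y z v : ℝ} (h₀ : x + y + z = v)
    (h₁ : (x ^ 2 - 2) + (y ^ 2 - 2) + (z ^ 2 - 2) = v ^ 2 - 2)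
    (h₂ : ((x ^ 2 - 2) ^ 2 - 2) + ((y ^ 2 - 2) ^ 2 - 2) + ((z ^ 2 - 2) ^ 2 - 2) =
      (v ^ 2 - 2) ^ 2 - 2) : v * (x * y * z + 2 * v) = 1 := by
  subst h₀
  have he₂ : x * y + y * z + z * x = -2 := by linarith
  linear_combination h₂ / 4 + (2 * (x + y + z) ^ 2 - (x * y + y * z + z * x) - 2) / 2 * he₂

theorem sq_mul_sub_two_sq_eq_one {x y z v : ℝ} (h₀ : x + y + z = v)
    (h₁ : (x ^ 2 - 2) + (y ^ 2 - 2) + (z ^ 2 - 2) = v ^ 2 - 2)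
    (h₂ : ((x ^ 2 - 2) ^ 2 - 2) + ((y ^ 2 - 2) ^ 2 - 2) + ((z ^ 2 - 2) ^ 2 - 2) =
      (v ^ 2 - 2) ^ 2 - 2)
    (h₃ : (((x ^ 2 - 2) ^ 2 - 2) ^ 2 - 2) + (((y ^ 2 - 2) ^ 2 - 2) ^ 2 - 2) +
      (((z ^ 2 - 2) ^ 2 - 2) ^ 2 - 2) = ((v ^ 2 - 2) ^ 2 - 2) ^ 2 - 2) :
    v ^ 2 * (v ^ 2 - 2) ^ 2 = 1 := by
  have he₃ := mul_add_eq_one_of_add_eq h₀ h₁ h₂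
  have he₃' := mul_add_eq_one_of_add_eq h₁ h₂ h₃
  have hprod : (x ^ 2 - 2) * (y ^ 2 - 2) * (z ^ 2 - 2) = (x * y * z + 2 * v) ^ 2 := by
    subst h₀
    have he₂ : x * y + y * z + z * x = -2 := by linarith
    linear_combination (-2) * (x * y + y * z + z * x + 2) * he₂
  have he₃sq : v ^ 2 * (x * y * z + 2 * v) ^ 2 = 1 := by rw [← mul_pow, he₃, one_pow]
  rw [hprod] at he₃'
  linear_combination (v ^ 2 * he₃' - (v ^ 2 - 2) * he₃sq) / 2

theorem two_mul_zcos_two_mul (m : ℕ) (N : ℤ) :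
    2 * zcos m (2 * N) = (2 * zcos m N) ^ 2 - 2 := by
  rw [zcos_two_mul]
  ring

theorem zcos_three_mul (m : ℕ) (N : ℤ) :
    zcos m (3 * N) = 4 * zcos m N ^ 3 - 3 * zcos m N := by
  rw [zcos, zcos, ← Real.cos_three_mul]
  congr 1
  push_cast
  ring

theorem zcos_five_mul (m : ℕ) (N : ℤ) :
    zcos m (5 * N) = 16 * zcos m N ^ 5 - 20 * zcos m N ^ 3 + 5 * zcos m N := by
  have h := two_mul_zcos_mul_zcos m (2 * N) (3 * N)
  rw [show 2 * N + 3 * N = 5 * N by ring, show 3 * N - 2 * N = N by ring, zcos_two_mul,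
    zcos_three_mul] at h
  linear_combination -h

theorem coprime_add_two_pow {m : ℕ} (hodd : Odd m) {j : ℕ} (hj : j ≠ 0) :
    (m + 2 ^ j).Coprime (2 * m) :=
  Nat.Coprime.mul_right (Nat.coprime_two_right.2 (hodd.add_even (even_two.pow_of_ne_zero hj)))
    (by simpa using hodd.coprime_two_left.pow_left j)

section

variable {m : ℕ} (hm : 0 < m)
include hm

theorem zcos_mul_add_zcos_mul {A B ψ n : ℤ} (h : zcos m A + zcos m B = zcos m ψ + zcos m n)
    {k : ℕ} (hk : k.Coprime (2 * m)) :
    zcos m (k * A) + zcos m (k * B) = zcos m (k * ψ) + zcos m (k * n) := by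
  have := aeval_zcos_mul hm (N := ![A, B, ψ, n]) (k := k)
    (P := .X 0 + .X 1 - (.X 2 + .X 3)) (by simpa [sub_eq_zero] using h) hk
  simpa [sub_eq_zero] using this

/-- The Galois automorphism raising roots of unity to the power `m + K` acts on `zcos m N` as
multiplication of `N` by `K`, up to a sign depending on the parity of `N`. -/
theorem zcos_mul_add_of_opposite_parity {A B ψ n : ℤ} (hA : 2 ∣ A - ψ) (hB : 2 ∣ B - ψ)
    (hn : ¬ 2 ∣ n - ψ) (h : zcos m A + zcos m B = zcos m ψ + zcos m n) {K : ℕ}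
    (hK : (m + K).Coprime (2 * m)) :
    zcos m (K * A) + zcos m (K * B) + zcos m (K * n) = zcos m (K * ψ) := by
  have hsign (N : ℤ) : zcos m ((m + K : ℕ) * N) = (-1) ^ N * zcos m (K * N) := by
    rw [← zcos_add_mul hm]
    congr 1
    push_cast
    ring
  have hσ := zcos_mul_add_zcos_mul hm h hK
  simp only [hsign] at hσ
  rcases Int.even_or_odd ψ with hψ | hψ
  · rw [(show Even A by grind).neg_one_zpow, (show Even B by grind).neg_one_zpow,
      hψ.neg_one_zpow, (show Odd n by grind).neg_one_zpow] at hσ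
    linarith
  · rw [(show Odd A by grind).neg_one_zpow, (show Odd B by grind).neg_one_zpow,
      hψ.neg_one_zpow, (show Even n by grind).neg_one_zpow] at hσ
    linarith

theorem zcos_eq_add_of_even (heven : Even m) {A B ψ n : ℤ} (hA : 2 ∣ A - ψ) (hB : 2 ∣ B - ψ)
    (hn : ¬ 2 ∣ n - ψ) (h : zcos m A + zcos m B = zcos m ψ + zcos m n) :
    zcos m ψ = zcos m A + zcos m B := by
  have hK : (m + 1).Coprime (2 * m) :=
    Nat.Coprime.mul_right (Nat.coprime_two_right.2 heven.add_one) (by simp)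
  have := zcos_mul_add_of_opposite_parity hm hA hB hn h hK
  simp only [Nat.cast_one, one_mul] at this
  linarith

theorem dvd_of_sq_mul_sub_two_sq_eq_one {ψ : ℤ}
    (h : (2 * zcos m ψ) ^ 2 * ((2 * zcos m ψ) ^ 2 - 2) ^ 2 = 1) :
    ((m : ℤ) ∣ 3 * ψ ∨ (m : ℤ) ∣ 5 * ψ) ∧ ¬ (m : ℤ) ∣ ψ := by
  simp only [← zcos_sq_eq_one_iff hm, zcos_three_mul, zcos_five_mul]
  generalize zcos m ψ = c at h
  constructor
  · have hfactor : (4 * c ^ 2 - 1) * (16 * c ^ 4 - 12 * c ^ 2 + 1) = 0 := by linear_combination h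
    rcases mul_eq_zero.1 hfactor with h₃ | h₅
    · exact .inl (by linear_combination (c ^ 2 - 1) * (4 * c ^ 2 - 1) * h₃)
    · exact .inr (by linear_combination (c ^ 2 - 1) * (16 * c ^ 4 - 12 * c ^ 2 + 1) * h₅)
  · intro h₁
    have : (2 * c) ^ 2 = 4 := by linear_combination 4 * h₁
    rw [this] at h
    norm_num at h

theorem dvd_of_odd_of_opposite_parity (hodd : Odd m) {A B ψ n : ℤ} (hA : 2 ∣ A - ψ)
    (hB : 2 ∣ B - ψ) (hn : ¬ 2 ∣ n - ψ) (h : zcos m A + zcos m B = zcos m ψ + zcos m n) :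
    ((m : ℤ) ∣ 3 * ψ ∨ (m : ℤ) ∣ 5 * ψ) ∧ ¬ (m : ℤ) ∣ ψ := by
  have hrel {j : ℕ} (hj : j ≠ 0) := zcos_mul_add_of_opposite_parity hm hA hB hn h
    (coprime_add_two_pow hodd hj)
  have h₁ := hrel one_ne_zero
  have h₂ := hrel two_ne_zero
  have h₃ := hrel three_ne_zero
  have h4 (N : ℤ) : (4 * N) = 2 * (2 * N) := by ring
  have h8 (N : ℤ) : (8 * N) = 2 * (2 * (2 * N)) := by ring
  norm_num [h4, h8] at h₁ h₂ h₃
  refine dvd_of_sq_mul_sub_two_sq_eq_one hm (sq_mul_sub_two_sq_eq_one (x := 2 * zcos m A)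
    (y := 2 * zcos m B) (z := -(2 * zcos m n)) (by linarith) ?_ ?_ ?_) <;>
  · rw [neg_sq]
    simp only [← two_mul_zcos_two_mul]
    linarith

theorem zcos_eq_of_odd_of_opposite_parity (hodd : Odd m) {A B ψ n : ℤ} (hA : 2 ∣ A - ψ)
    (hB : 2 ∣ B - ψ) (hn : ¬ 2 ∣ n - ψ) (h : zcos m A + zcos m B = zcos m ψ + zcos m n) :
    2 * (zcos m A + zcos m B) * zcos m ψ =
      2 * (zcos m A ^ 2 + zcos m A * zcos m B + zcos m B ^ 2) - 1 := by
  have h₁ := zcos_mul_add_of_opposite_parity hm hA hB hn h (coprime_add_two_pow hodd one_ne_zero)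
  norm_num [zcos_two_mul] at h₁
  have hzn : zcos m n = zcos m A + zcos m B - zcos m ψ := by linarith
  rw [hzn] at h₁
  linarith

end

theorem add_eq_of_forall_exists_add_eq {c : ℤ → ℝ} {J : Set ℤ} {C : ℝ} (hc : StrictAntiOn c J)
    (hJ : ∀ x ∈ J, ∃ y ∈ J, c x + c y = C) {p P : ℤ} (hp : IsLeast J p) (hP : IsGreatest J P) :
    c p + c P = C := by
  obtain ⟨y, hyJ, hy⟩ := hJ p hp.1
  obtain ⟨z, hzJ, hz⟩ := hJ P hP.1
  have hyP := hc.antitoneOn hyJ hP.1 (hP.2 hyJ)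
  have hpz := hc.antitoneOn hp.1 hzJ (hp.2 hzJ)
  linarith

/-- A pairing `x ↦ y` with constant `c x + c y` reverses the order, hence matches the least element
with the greatest one, and the second least with the second greatest. -/
theorem add_eq_and_add_eq_of_forall_exists_add_eq {c : ℤ → ℝ} {J : Set ℤ} {C : ℝ}
    (hc : StrictAntiOn c J) (hJ : ∀ x ∈ J, ∃ y ∈ J, c x + c y = C) {p P q Q : ℤ}
    (hp : IsLeast J p) (hP : IsGreatest J P)
    (hq : IsLeast (J \ {p, P}) q) (hQ : IsGreatest (J \ {p, P}) Q) :
    c p + c P = C ∧ c q + c Q = C := by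
  have hpP := add_eq_of_forall_exists_add_eq hc hJ hp hP
  refine ⟨hpP, add_eq_of_forall_exists_add_eq (hc.mono Set.sdiff_subset) ?_ hq hQ⟩
  rintro x ⟨hx, hxpP⟩
  obtain ⟨y, hy, hxy⟩ := hJ x hx
  refine ⟨y, ⟨hy, ?_⟩, hxy⟩
  rintro (rfl | rfl)
  · exact hxpP (.inr (hc.injOn hx hP.1 (by linarith)))
  · exact hxpP (.inl (hc.injOn hx hp.1 (by linarith)))

section

variable {m : ℕ} (hm : 0 < m)
include hm

theorem opposite_parity_unique {A B ψ ψ' n n' : ℤ} (hC : zcos m A + zcos m B ≠ 0)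
    (hA : 2 ∣ A - ψ) (hB : 2 ∣ B - ψ) (hn : ¬ 2 ∣ n - ψ)
    (h : zcos m A + zcos m B = zcos m ψ + zcos m n)
    (hψ' : 2 ∣ ψ' - ψ) (hn' : ¬ 2 ∣ n' - ψ')
    (h' : zcos m A + zcos m B = zcos m ψ' + zcos m n') : zcos m ψ = zcos m ψ' := by
  have hA' : 2 ∣ A - ψ' := by lia
  have hB' : 2 ∣ B - ψ' := by lia
  rcases Nat.even_or_odd m with heven | hodd
  · rw [zcos_eq_add_of_even hm heven hA hB hn h, zcos_eq_add_of_even hm heven hA' hB' hn' h']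
  · refine mul_left_cancel₀ (mul_ne_zero two_ne_zero hC) ?_
    rw [zcos_eq_of_odd_of_opposite_parity hm hodd hA hB hn h,
      zcos_eq_of_odd_of_opposite_parity hm hodd hA' hB' hn' h']

theorem two_dvd_of_add_eq_add {ψ n y : ℤ} (hy : y ∈ Set.Icc (0 : ℤ) m) (hyψ : 2 ∣ y - ψ)
    (h : zcos m ψ + zcos m y = zcos m ψ + zcos m n) : 2 ∣ n - ψ := by
  obtain ⟨n', hn', hpar, hcos⟩ := exists_zcos_eq hm n
  have : n' = y := (strictAntiOn_zcos hm).injOn hn' hy (by linarith)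
  lia

end

/-- The angles `ψ ∈ [0, m]` with the parity of `A` for which `C - cos ψ ≤ 1`. -/
def angleWindow (m : ℕ) (A : ℤ) (C : ℝ) : Set ℤ :=
  {ψ ∈ Set.Icc 0 (m : ℤ) | 2 ∣ ψ - A ∧ C - 1 ≤ zcos m ψ}

section

variable {m : ℕ} (hm : 0 < m) {A B : ℤ} {C : ℝ} (hC : zcos m A + zcos m B = C)
  (hpar : 2 ∣ B - A)
include hm hC hpar

theorem exists_pairing_angleWindow (hA : A ∈ Set.Icc 0 (m : ℤ)) (hB : B ∈ Set.Icc 0 (m : ℤ))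
    (hC0 : 0 < C) (hbad : ∀ ψ ∈ angleWindow m A C, ∃ n, C = zcos m ψ + zcos m n) :
    ∃ ψ₀, A ≠ ψ₀ ∧ B ≠ ψ₀ ∧
      (∀ x ∈ angleWindow m A C \ {ψ₀}, ∃ y ∈ angleWindow m A C \ {ψ₀},
        zcos m x + zcos m y = C) ∧
      (ψ₀ ∈ angleWindow m A C → ∃ n, ¬ 2 ∣ n - ψ₀ ∧ C = zcos m ψ₀ + zcos m n) := by
  have hpartner {x : ℤ} (hx : x ∈ angleWindow m A C) :
      (∃ y ∈ angleWindow m A C, zcos m x + zcos m y = C) ∨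
        ∃ n, ¬ 2 ∣ n - x ∧ C = zcos m x + zcos m n := by
    obtain ⟨n, hn⟩ := hbad x hx
    obtain ⟨y, hy, hyn, hcos⟩ := exists_zcos_eq hm n
    by_cases hpar' : 2 ∣ n - x
    · exact .inl ⟨y, ⟨hy, by have := hx.2.1; lia, by linarith [zcos_le_one m x]⟩, by linarith⟩
    · exact .inr ⟨n, hpar', hn⟩
  by_cases hex : ∃ ψ₀ ∈ angleWindow m A C, ∃ n, ¬ 2 ∣ n - ψ₀ ∧ C = zcos m ψ₀ + zcos m n
  · obtain ⟨ψ₀, hψ₀, n, hn, hcos⟩ := hex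
    have hψ₀A := hψ₀.2.1
    have hne {y : ℤ} (hy : y ∈ Set.Icc (0 : ℤ) m) (hyA : 2 ∣ y - A) :
        zcos m ψ₀ + zcos m y ≠ C := fun h =>
      hn (two_dvd_of_add_eq_add hm hy (by lia) (h.trans hcos))
    refine ⟨ψ₀, ?_, ?_, ?_, fun _ => ⟨n, hn, hcos⟩⟩
    · rintro rfl
      exact hne hB hpar hC
    · rintro rfl
      exact hne hA (by simp) (by linarith)
    · rintro x ⟨hx, hxψ₀⟩
      have hxA := hx.2.1
      rcases hpartner hx with ⟨y, hy, hxy⟩ | ⟨n', hn', hcos'⟩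
      · refine ⟨y, ⟨hy, ?_⟩, hxy⟩
        rintro rfl
        exact hne hx.1 hxA (by linarith)
      · refine absurd ((strictAntiOn_zcos hm).injOn hx.1 hψ₀.1 ?_) hxψ₀
        exact (opposite_parity_unique hm (by rw [hC]; exact hC0.ne') (by lia) (by lia) hn
          (hC.trans hcos) (by lia) hn' (hC.trans hcos')).symm
  · push Not at hex
    refine ⟨-1, by grind, by grind, fun x hx => ?_, fun h => by grind [angleWindow]⟩
    rcases hpartner hx.1 with ⟨y, hy, hxy⟩ | ⟨n, hn, hcos⟩
    · refine ⟨y, ⟨hy, ?_⟩, hxy⟩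
      rintro rfl
      exact absurd hy.1.1 (by norm_num)
    · exact absurd hcos (hex x hx.1 n hn)

end

section

variable {m : ℕ} (hm : 0 < m)
include hm

theorem exists_angleWindow_eq {A : ℤ} {C : ℝ} (hA : A ∈ angleWindow m A C) (hC0 : 0 < C) :
    ∃ e r : ℤ, (e = 0 ∨ e = 1) ∧ 2 ∣ A - e ∧ r < m ∧ 2 ∣ r - e ∧
      angleWindow m A C = {ψ ∈ Set.Icc e r | 2 ∣ ψ - e} := by
  obtain ⟨r, hr, hmax⟩ := Int.exists_greatest_of_bdd (P := (· ∈ angleWindow m A C))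
    ⟨m, fun _ h => h.1.2⟩ ⟨A, hA⟩
  have hrA := hr.2.1
  refine ⟨A % 2, r, by lia, by lia, ?_, by lia, Set.Subset.antisymm ?_ ?_⟩
  · refine lt_of_le_of_ne hr.1.2 ?_
    rintro rfl
    linarith [hr.2.2, zcos_self hm]
  · rintro ψ hψ
    have := hψ.1.1
    have := hψ.2.1
    exact ⟨⟨by lia, hmax ψ hψ⟩, by lia⟩
  · rintro ψ ⟨⟨heψ, hψr⟩, hψ⟩
    have hψm : ψ ∈ Set.Icc (0 : ℤ) m := ⟨by lia, hψr.trans hr.1.2⟩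
    exact ⟨hψm, by lia, hr.2.2.trans ((strictAntiOn_zcos hm).antitoneOn hψm hr.1 hψr)⟩

theorem add_lt_of_zcos_add_pos {x y : ℤ} (hx : x ∈ Set.Icc (0 : ℤ) m) (hy : y ∈ Set.Icc (0 : ℤ) m)
    (h : 0 < zcos m x + zcos m y) : x + y < m := by
  by_contra! hxy
  have := (strictAntiOn_zcos hm).antitoneOn (a := m - x) (b := y) (by grind) hy (by lia)
  rw [zcos_sub_self hm] at this
  linarith

theorem zcos_sub_lt_zcos_sub {x y : ℤ} (hx : 0 ≤ x) (hxy : x < y) (hy : x + y + 2 < m) :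
    zcos m x - zcos m (x + 2) < zcos m y - zcos m (y + 2) := by
  rw [zcos_sub_zcos_add_two, zcos_sub_zcos_add_two]
  have := zsin_pos hm (N := 1) (by lia) (by lia)
  have := zsin_lt_zsin hm (M := x + 1) (N := y + 1) (by lia) (by lia) (by lia)
  gcongr

/-- Matching the two ends of the window twice gives `cos p - cos q = cos Q - cos P`, which forces
the exceptional angle towards `e` because the gaps `cos x - cos (x + 2)` increase with `x`. -/
theorem exceptional_angle_eq_or_eq {e r ψ₀ A : ℤ} {C : ℝ} (he : 0 ≤ e) (hr : r < m)
    (hre : 2 ∣ r - e) (hC0 : 0 < C)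
    (hJ : ∀ x ∈ {ψ ∈ Set.Icc e r | 2 ∣ ψ - e} \ {ψ₀},
      ∃ y ∈ {ψ ∈ Set.Icc e r | 2 ∣ ψ - e} \ {ψ₀}, zcos m x + zcos m y = C)
    (hA : A ∈ {ψ ∈ Set.Icc e r | 2 ∣ ψ - e} \ {ψ₀}) (heA : e + 4 ≤ A) :
    ψ₀ = e ∨ ψ₀ = e + 2 := by
  have hends (p P q Q : ℤ) := add_eq_and_add_eq_of_forall_exists_add_eq
    (p := p) (P := P) (q := q) (Q := Q) ((strictAntiOn_zcos hm).mono (by grind)) hJ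
  simp only [IsLeast, IsGreatest, lowerBounds, upperBounds, Set.mem_ofPred_eq, Set.mem_sdiff,
    Set.mem_Icc, Set.mem_singleton_iff, Set.mem_insert_iff] at hends hA
  clear hJ
  by_contra! hψ₀
  obtain ⟨h_e, h_e2⟩ := hψ₀
  have hgap {y : ℤ} (hy : e < y) (hlt : e + y + 2 < m) := zcos_sub_lt_zcos_sub hm he hy hlt
  rcases eq_or_ne ψ₀ r with h | h_r
  · obtain ⟨hout, hin⟩ := hends e (r - 2) (e + 2) (r - 4)
      ⟨by lia, by lia⟩ ⟨by lia, by lia⟩ ⟨by lia, by lia⟩ ⟨by lia, by lia⟩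
    have hlt := add_lt_of_zcos_add_pos hm (by grind) (by grind) (hC0.trans_eq hout.symm)
    have := hgap (y := r - 4) (by lia) (by lia)
    ring_nf at this hout hin
    linarith
  rcases eq_or_ne ψ₀ (r - 2) with h | h_r2
  · obtain ⟨hout, hin⟩ := hends e r (e + 2) (r - 4)
      ⟨by lia, by lia⟩ ⟨by lia, by lia⟩ ⟨by lia, by lia⟩ ⟨by lia, by lia⟩
    have hlt := add_lt_of_zcos_add_pos hm (by grind) (by grind) (hC0.trans_eq hout.symm)
    have := hgap (y := r - 4) (by lia) (by lia)
    have := (strictAntiOn_zcos hm) (a := r - 2) (b := r) (by grind) (by grind) (by lia)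
    ring_nf at *
    linarith
  · obtain ⟨hout, hin⟩ := hends e r (e + 2) (r - 2)
      ⟨by lia, by lia⟩ ⟨by lia, by lia⟩ ⟨by lia, by lia⟩ ⟨by lia, by lia⟩
    have hlt := add_lt_of_zcos_add_pos hm (by grind) (by grind) (hC0.trans_eq hout.symm)
    have := hgap (y := r - 2) (by lia) (by lia)
    ring_nf at this hout hin
    linarith

theorem exceptional_angle_cases {e r ψ₀ A : ℤ} {C : ℝ} (he : 0 ≤ e) (hr : r < m)
    (hre : 2 ∣ r - e) (hC0 : 0 < C)
    (hJ : ∀ x ∈ {ψ ∈ Set.Icc e r | 2 ∣ ψ - e} \ {ψ₀},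
      ∃ y ∈ {ψ ∈ Set.Icc e r | 2 ∣ ψ - e} \ {ψ₀}, zcos m x + zcos m y = C)
    (hA : A ∈ {ψ ∈ Set.Icc e r | 2 ∣ ψ - e} \ {ψ₀}) (heA : e + 4 ≤ A) :
    (ψ₀ = e ∧ r = e + 4) ∨ (ψ₀ = e + 2 ∧ r = e + 4) ∨ (ψ₀ = e + 2 ∧ e + 6 ≤ r ∧
      zcos m e + zcos m r = C ∧ zcos m (e + 4) + zcos m (r - 2) = C) := by
  have hψ₀ := exceptional_angle_eq_or_eq hm he hr hre hC0 hJ hA heA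
  have hends (p P q Q : ℤ) := add_eq_and_add_eq_of_forall_exists_add_eq
    (p := p) (P := P) (q := q) (Q := Q) ((strictAntiOn_zcos hm).mono (by grind)) hJ
  simp only [IsLeast, IsGreatest, lowerBounds, upperBounds, Set.mem_ofPred_eq, Set.mem_sdiff,
    Set.mem_Icc, Set.mem_singleton_iff, Set.mem_insert_iff] at hends hA
  clear hJ
  obtain hr4 | hr6 : r = e + 4 ∨ e + 6 ≤ r := by lia
  · exact hψ₀.imp (⟨·, hr4⟩) fun h => .inl ⟨h, hr4⟩
  rcases hψ₀ with h | h
  · obtain ⟨hout, hin⟩ := hends (e + 2) r (e + 4) (r - 2)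
      ⟨by lia, by lia⟩ ⟨by lia, by lia⟩ ⟨by lia, by lia⟩ ⟨by lia, by lia⟩
    have hlt := add_lt_of_zcos_add_pos hm (by grind) (by grind) (hC0.trans_eq hout.symm)
    have := zcos_sub_lt_zcos_sub hm (x := e + 2) (y := r - 2) (by lia) (by lia) (by lia)
    ring_nf at this hout hin
    linarith
  · exact .inr (.inr ⟨h, hr6, hends e r (e + 4) (r - 2)
      ⟨by lia, by lia⟩ ⟨by lia, by lia⟩ ⟨by lia, by lia⟩ ⟨by lia, by lia⟩⟩)

end

theorem dvd_three_mul_of_zcos_eq_half {m : ℕ} (hm : 0 < m) {N : ℤ} (h : zcos m N = 1 / 2) :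
    (m : ℤ) ∣ 3 * N := by
  rw [← zcos_sq_eq_one_iff hm, zcos_three_mul, h]
  norm_num

theorem zcos_add_four_add_zcos (m : ℕ) (N : ℤ) :
    zcos m (N + 4) + zcos m N = 2 * zcos m (N + 2) * zcos m 2 := by
  rw [mul_right_comm, two_mul_zcos_mul_zcos]
  ring_nf

theorem one_ne_zcos_two_add_zcos_four {m : ℕ} (heven : Even m) (hlt : 6 < m) :
    zcos m 4 + zcos m 2 ≠ 1 := by
  intro h
  have hsq : zcos m 4 = 2 * zcos m 2 ^ 2 - 1 := zcos_two_mul m 2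
  obtain rfl | hge : m = 8 ∨ 10 ≤ m := by
    obtain ⟨k, rfl⟩ := heven
    omega
  · have : zcos 8 4 = 0 := by
      rw [zcos, show Real.pi * (4 : ℤ) / (8 : ℕ) = Real.pi / 2 by push_cast; ring,
        Real.cos_pi_div_two]
    nlinarith
  · have hcos : (1 + √5) / 4 ≤ zcos m 2 := by
      have hm' : (10 : ℝ) ≤ m := mod_cast hge
      rw [← Real.cos_pi_div_five, zcos]
      refine Real.cos_le_cos_of_nonneg_of_le_pi (by positivity) (by linarith [Real.pi_pos]) ?_
      push_cast
      rw [div_le_div_iff₀ (by linarith) (by norm_num)]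
      nlinarith [Real.pi_pos]
    have h5 : (2.2 : ℝ) < √5 := by
      rw [Real.lt_sqrt] <;> norm_num
    nlinarith

theorem zcos_one_sub_lt {m : ℕ} (hm : m = 9 ∨ m = 15) :
    2 * zsin m 1 < zcos m 1 - zcos m 5 := by
  have hpi := Real.pi_lt_d2
  have hpi0 := Real.pi_pos
  have hcos := Real.one_sub_sq_div_two_le_cos (x := Real.pi / m)
  have hsin := Real.sin_lt (x := Real.pi / m) (by rcases hm with rfl | rfl <;> positivity)
  rcases hm with rfl | rfl
  · have h5 : zcos 9 5 < 0 := by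
      have h4 : zcos 9 5 = -zcos 9 4 := zcos_sub_self (by lia) 4
      linarith [zcos_pos (m := 9) (by lia) (N := 4) (by lia) (by lia)]
    simp only [zsin, zcos, Int.cast_one, mul_one, Nat.cast_ofNat] at *
    nlinarith
  · have h5 : zcos 15 5 = 1 / 2 := by
      rw [zcos, ← Real.cos_pi_div_three]
      congr 1
      push_cast
      ring
    simp only [zsin, zcos, Int.cast_one, mul_one, Nat.cast_ofNat] at *
    nlinarith

section

variable {m : ℕ} {C : ℝ} {e r n : ℤ}

theorem eq_twelve_of_exceptional_angle (he : e = 0 ∨ e = 1) (hem : 2 * (e + 3) < m)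
    (hn : ¬ 2 ∣ n - e) (h : zcos m (e + 4) + zcos m (e + 2) = zcos m e + zcos m n) :
    e = 1 ∧ m = 12 := by
  have hm : 0 < m := by lia
  rcases Nat.even_or_odd m with heven | hodd
  · have hC := zcos_eq_add_of_even hm heven (by lia) (by lia) hn h
    rcases he with rfl | rfl
    · exact absurd (hC.symm.trans (zcos_zero m)) (one_ne_zcos_two_add_zcos_four heven (by lia))
    · have hpos := zcos_pos hm (N := 1) (by lia) (by lia)
      have hprod := two_mul_zcos_mul_zcos m 1 4
      norm_num at hC hprod
      have h4 : zcos m 4 = 1 / 2 := by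
        refine mul_left_cancel₀ hpos.ne' ?_
        linarith
      have := Int.le_of_dvd (by norm_num) (dvd_three_mul_of_zcos_eq_half hm h4)
      have := dvd_three_mul_of_zcos_eq_half hm h4
      have : m ≤ 12 := by lia
      exact ⟨rfl, by interval_cases m <;> lia⟩
  · obtain ⟨hdvd, hnot⟩ := dvd_of_odd_of_opposite_parity hm hodd (by lia) (by lia) hn h
    rcases he with rfl | rfl
    · exact absurd (dvd_zero _) hnot
    · have : (m : ℤ) ≤ 5 := by
        rcases hdvd with hdvd | hdvd <;> have := Int.le_of_dvd (by norm_num) hdvd <;> lia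
      lia

theorem dvd_fifteen_of_exceptional_angle (he : e = 0 ∨ e = 1) (hodd : Odd m)
    (hdvd : (m : ℤ) ∣ 3 * (e + 2) ∨ (m : ℤ) ∣ 5 * (e + 2)) (hem : 2 * (e + 2) < m) :
    (e = 0 ∧ m = 5) ∨ (e = 1 ∧ (m = 9 ∨ m = 15)) := by
  obtain ⟨k, rfl⟩ := hodd
  have : (2 * k + 1 : ℤ) ≤ 15 := by
    rcases hdvd with hdvd | hdvd <;> have := Int.le_of_dvd (by lia) hdvd <;> lia
  have : k ≤ 7 := by lia
  interval_cases k <;> lia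

theorem eq_of_exceptional_angle_add_two (he : e = 0 ∨ e = 1) (hem : 2 * (e + 2) < m)
    (hn : ¬ 2 ∣ n - (e + 2)) (h : zcos m (e + 4) + zcos m e = zcos m (e + 2) + zcos m n) :
    (e = 0 ∧ (m = 5 ∨ m = 6)) ∨ (e = 1 ∧ (m = 9 ∨ m = 15)) := by
  have hm : 0 < m := by lia
  rcases Nat.even_or_odd m with heven | hodd
  · have hC := zcos_eq_add_of_even hm heven (by lia) (by lia) hn h
    have hpos := zcos_pos hm (N := e + 2) (by lia) hem
    rw [zcos_add_four_add_zcos m] at hC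
    have h2 : zcos m 2 = 1 / 2 := by
      refine mul_left_cancel₀ hpos.ne' ?_
      linarith
    have := Int.le_of_dvd (by norm_num) (dvd_three_mul_of_zcos_eq_half hm h2)
    obtain ⟨k, rfl⟩ := heven
    lia
  · have hdvd := (dvd_of_odd_of_opposite_parity hm hodd (by lia) (by lia) hn h).1
    have := dvd_fifteen_of_exceptional_angle he hodd hdvd hem
    tauto

theorem not_exceptional_angle_add_two (he : e = 0 ∨ e = 1) (hr : r < m) (hre : 2 ∣ r - e)
    (her : e + 6 ≤ r) (hC0 : 0 < C) (hout : zcos m e + zcos m r = C)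
    (hin : zcos m (e + 4) + zcos m (r - 2) = C) (hn : ¬ 2 ∣ n - (e + 2)) :
    C ≠ zcos m (e + 2) + zcos m n := by
  intro h
  have hm : 0 < m := by lia
  have hanti := strictAntiOn_zcos hm
  rcases Nat.even_or_odd m with heven | hodd
  · have hC := zcos_eq_add_of_even hm heven (by lia) (by lia) hn (hout.trans h)
    have hr1 : zcos m r < 0 := by
      linarith [hanti (a := e) (b := e + 2) (by grind) (by grind) (by lia)]
    have hr2 : 0 < zcos m (r - 2) := by
      linarith [hanti (a := e + 2) (b := e + 4) (by grind) (by grind) (by lia)]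
    have hrm : r - 2 = m - r := by
      have : m < 2 * r := by
        by_contra! hle
        exact hr1.not_ge (zcos_nonneg hm (by lia) hle)
      have : 2 * (r - 2) < m := by
        by_contra! hle
        have := zcos_nonneg hm (N := m - (r - 2)) (by lia) (by lia)
        rw [zcos_sub_self hm] at this
        linarith
      obtain ⟨k, rfl⟩ := heven
      lia
    rw [hrm, zcos_sub_self hm] at hin
    have := zcos_add_four_add_zcos m e
    have h2 : zcos m 2 = 1 := by
      refine mul_left_cancel₀ (b := zcos m 2) (hC.trans hout ▸ hC0).ne' ?_
      linarith
    have := hanti (a := 0) (b := 2) (by grind) (by grind) (by lia)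
    rw [zcos_zero] at this
    linarith
  · have hdvd := (dvd_of_odd_of_opposite_parity hm hodd (by lia) (by lia) hn (hout.trans h)).1
    obtain ⟨-, rfl⟩ | ⟨rfl, hm'⟩ := dvd_fifteen_of_exceptional_angle he hodd hdvd (by lia)
    · lia
    · have hgap := zcos_sub_zcos_add_two m (r - 2)
      have := mul_le_mul_of_nonneg_right (zsin_le_one m (r - 1))
        (zsin_pos hm (N := 1) (by lia) (by lia)).le
      have := zcos_one_sub_lt hm'
      ring_nf at *
      linarith

end

theorem eq_of_forall_angleWindow {m : ℕ} {a b : ℤ} (ha : 0 < a) (hab : a ≤ b) (hb : 2 * b < m)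
    (hbad : ∀ ψ ∈ angleWindow m (a + b) (2 * zcos m a * zcos m b),
      ∃ n, 2 * zcos m a * zcos m b = zcos m ψ + zcos m n) :
    (a = 1 ∧ b ≤ 2) ∨ (a = 1 ∧ b = 4 ∧ m = 12) ∨
      (a = 2 ∧ (b = 2 ∧ (m = 5 ∨ m = 6) ∨ b = 3 ∧ (m = 9 ∨ m = 15))) := by
  have hm : 0 < m := by lia
  have hC := (two_mul_zcos_mul_zcos m a b).symm
  have hC0 : 0 < 2 * zcos m a * zcos m b := by
    have := zcos_pos hm ha.le (by lia)
    have := zcos_pos hm (ha.le.trans hab) hb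
    positivity
  generalize 2 * zcos m a * zcos m b = C at *
  obtain ⟨ψ₀, hA, hB, hpair, hn⟩ := exists_pairing_angleWindow hm hC (by lia)
    ⟨by lia, by lia⟩ ⟨by lia, by lia⟩ hC0 hbad
  have hAw : a + b ∈ angleWindow m (a + b) C :=
    ⟨⟨by lia, by lia⟩, by simp, by linarith [zcos_le_one m (b - a)]⟩
  obtain ⟨e, r, he, hAe, hr, hre, hwindow⟩ := exists_angleWindow_eq hm hAw hC0
  rw [hwindow] at hpair hn hAw
  obtain hle | heA : a + b ≤ e + 2 ∨ e + 4 ≤ a + b := by lia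
  · lia
  have hAr : a + b ≤ r := hAw.1.2
  rcases exceptional_angle_cases hm (by lia) hr hre hC0 hpair ⟨hAw, hA⟩ heA with
    ⟨rfl, rfl⟩ | ⟨rfl, rfl⟩ | ⟨rfl, her, hout, hin⟩
  · obtain ⟨n, hn, h⟩ := hn ⟨⟨le_rfl, by lia⟩, by simp⟩
    obtain rfl : a = 1 := by lia
    obtain rfl : b = ψ₀ + 3 := by lia
    have := eq_twelve_of_exceptional_angle he hb hn (by rw [← h, ← hC]; ring_nf)
    lia
  · obtain ⟨n, hn, h⟩ := hn ⟨⟨by lia, by lia⟩, by simp⟩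
    obtain rfl : a = 2 := by lia
    obtain rfl : b = e + 2 := by lia
    have := eq_of_exceptional_angle_add_two he hb hn (by rw [← h, ← hC]; ring_nf)
    lia
  · obtain ⟨n, hn, h⟩ := hn ⟨⟨by lia, by lia⟩, by simp⟩
    exact absurd h (not_exceptional_angle_add_two he hr hre her hC0 hout hin hn)

section

variable {m : ℕ} (hm : 0 < m)
include hm

theorem abs_zcos_eq {N z : ℤ} (hz : 0 ≤ z) (hzm : 2 * z ≤ m)
    (h : (m : ℤ) ∣ N - z ∨ (m : ℤ) ∣ N + z) : |zcos m N| = zcos m z := by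
  rw [← abs_of_nonneg (zcos_nonneg hm hz hzm)]
  rcases h with ⟨q, hq⟩ | ⟨q, hq⟩
  · rw [show N = z + m * q by lia, abs_zcos_add_mul hm]
  · rw [show N = -z + m * q by lia, abs_zcos_add_mul hm, zcos_neg]

theorem abs_mul_lt_sq_of_residues {k a b x y z : ℤ}
    (hx : x ∈ Set.Icc 0 (m / 2 : ℤ)) (hy : y ∈ Set.Icc 0 (m / 2 : ℤ)) (hz : 2 * z ≤ m)
    (ha : (m : ℤ) ∣ k * a - x ∨ (m : ℤ) ∣ k * a + x)
    (hb : (m : ℤ) ∣ k * b - y ∨ (m : ℤ) ∣ k * b + y)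
    (hres : ∀ s ∈ Finset.Ioo 0 (m : ℤ), 2 * s < m → s ≠ a → s ≠ b →
      ∃ w ∈ Finset.Icc 0 z, (m : ℤ) ∣ k * s - w ∨ (m : ℤ) ∣ k * s + w)
    (h : zcos m x * zcos m y < zcos m z ^ 2) {s : ℤ} (hs0 : 0 < s) (hsm : 2 * s < m)
    (hsa : s ≠ a) (hsb : s ≠ b) :
    |zcos m (k * a) * zcos m (k * b)| < zcos m (k * s) ^ 2 := by
  obtain ⟨w, hw, hsw⟩ := hres s (Finset.mem_Ioo.2 ⟨hs0, by lia⟩) hsm hsa hsb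
  obtain ⟨hw0, hwz⟩ := Finset.mem_Icc.1 hw
  rw [abs_mul, ← sq_abs (zcos m (k * s)), abs_zcos_eq hm hx.1 (by grind) ha,
    abs_zcos_eq hm hy.1 (by grind) hb, abs_zcos_eq hm hw0 (by lia) hsw]
  refine h.trans_le (pow_le_pow_left₀ (zcos_nonneg hm (by lia) hz) ?_ 2)
  exact (strictAntiOn_zcos hm).antitoneOn ⟨hw0, by lia⟩ ⟨by lia, by lia⟩ hwz

theorem zcos_mul_zcos_lt_sq {x y z : ℤ} (hz : 0 ≤ z) (hzx : z < x) (hzy : z < y)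
    (hx : 2 * x ≤ m) (hy : 2 * y ≤ m) : zcos m x * zcos m y < zcos m z ^ 2 := by
  have hanti := strictAntiOn_zcos hm
  rw [sq]
  exact mul_lt_mul'' (hanti (by grind) (by grind) hzx) (hanti (by grind) (by grind) hzy)
    (zcos_nonneg hm (by lia) hx) (zcos_nonneg hm (by lia) hy)

end

theorem zcos_fifteen_lt : zcos 15 7 * zcos 15 3 < zcos 15 6 ^ 2 := by
  have h7 : zcos 15 7 < 0.105 := by
    rw [zcos, show Real.pi * (7 : ℤ) / (15 : ℕ) = Real.pi / 2 - Real.pi / 30 by push_cast; ring,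
      Real.cos_pi_div_two_sub]
    linarith [Real.sin_lt (x := Real.pi / 30) (by positivity), Real.pi_lt_d2]
  have h3 : zcos 15 3 = (1 + √5) / 4 := by
    rw [zcos, ← Real.cos_pi_div_five]
    congr 1
    push_cast
    ring
  have h6 : zcos 15 6 = 2 * zcos 15 3 ^ 2 - 1 := zcos_two_mul 15 3
  have hlt : √5 < 2.24 := by rw [Real.sqrt_lt'] <;> norm_num
  have hgt : 2.23 < √5 := by rw [Real.lt_sqrt] <;> norm_num
  have hsq : √5 ^ 2 = 5 := Real.sq_sqrt (by norm_num)
  rw [h6, h3]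
  nlinarith [Real.sqrt_nonneg 5]

/-- The multiplier `k` moves `k * a` modulo `m` next to `m / 2`, where the cosine is small. -/
theorem exists_coprime_forall_abs_mul_lt_sq {m : ℕ} {a b : ℤ}
    (h : (a = 1 ∧ b = 4 ∧ m = 12) ∨
      (a = 2 ∧ (b = 2 ∧ (m = 5 ∨ m = 6) ∨ b = 3 ∧ (m = 9 ∨ m = 15)))) :
    ∃ k : ℕ, k.Coprime (2 * m) ∧ ∀ s : ℤ, 0 < s → 2 * s < m → s ≠ a → s ≠ b →
      |zcos m (k * a) * zcos m (k * b)| < zcos m (k * s) ^ 2 := by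
  have hm : 0 < m := by lia
  have hlt {x y z : ℤ} := zcos_mul_zcos_lt_sq hm (x := x) (y := y) (z := z)
  have hres {k x y z : ℤ} :=
    abs_mul_lt_sq_of_residues hm (k := k) (a := a) (b := b) (x := x) (y := y) (z := z)
  obtain ⟨rfl, rfl, rfl⟩ | ⟨rfl, ⟨rfl, rfl | rfl⟩ | ⟨rfl, rfl | rfl⟩⟩ := h
  · exact ⟨5, by decide, fun s => hres (x := 5) (y := 4) (z := 3) (by decide) (by decide)
      (by decide) (by decide) (by decide) (by decide)
      (hlt (by decide) (by decide) (by decide) (by decide) (by decide))⟩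
  · exact ⟨1, by decide, fun s => hres (x := 2) (y := 2) (z := 1) (by decide) (by decide)
      (by decide) (by decide) (by decide) (by decide)
      (hlt (by decide) (by decide) (by decide) (by decide) (by decide))⟩
  · exact ⟨1, by decide, fun s => hres (x := 2) (y := 2) (z := 1) (by decide) (by decide)
      (by decide) (by decide) (by decide) (by decide)
      (hlt (by decide) (by decide) (by decide) (by decide) (by decide))⟩
  · exact ⟨11, by decide, fun s => hres (x := 4) (y := 3) (z := 2) (by decide) (by decide)
      (by decide) (by decide) (by decide) (by decide)
      (hlt (by decide) (by decide) (by decide) (by decide) (by decide))⟩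
  · exact ⟨19, by decide, fun s => hres (x := 7) (y := 3) (z := 6) (by decide) (by decide)
      (by decide) (by decide) (by decide) (by decide) zcos_fifteen_lt⟩

theorem exists_isolated_angle {m : ℕ} {a b : ℤ} (ha : 0 < a) (hb : 0 < b) (ham : 2 * a < m)
    (hbm : 2 * b < m)
    (hle : ∀ k : ℕ, k.Coprime (2 * m) → ∃ s : ℤ, 0 < s ∧ 2 * s < m ∧ s ≠ a ∧ s ≠ b ∧
      zcos m (k * s) ^ 2 ≤ |zcos m (k * a) * zcos m (k * b)|)
    (hge : ∃ s : ℤ, 0 < s ∧ 2 * s < m ∧ s ≠ a ∧ s ≠ b ∧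
      zcos m a * zcos m b ≤ zcos m s ^ 2) :
    ∃ ψ ∈ angleWindow m (a + b) (2 * zcos m a * zcos m b),
      ∀ n, 2 * zcos m a * zcos m b ≠ zcos m ψ + zcos m n := by
  wlog hab : a ≤ b generalizing a b
  · have := this hb ha hbm ham (by simpa only [mul_comm, and_left_comm] using hle)
      (by simpa only [mul_comm, and_left_comm] using hge) (by lia)
    rwa [add_comm, mul_right_comm] at this
  have hm : 0 < m := by lia
  by_contra! hbad
  rcases eq_of_forall_angleWindow ha hab hbm hbad with ⟨rfl, hb2⟩ | hexc
  · obtain ⟨s, hs, hsm, hsa, hsb, hge⟩ := hge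
    have hanti := strictAntiOn_zcos hm
    have hsb : zcos m s < zcos m b := hanti (by grind) (by grind) (by lia)
    have hba : zcos m b ≤ zcos m 1 := hanti.antitoneOn (by grind) (by grind) hab
    nlinarith [zcos_pos hm hs.le hsm]
  · obtain ⟨k, hk, hlt⟩ := exists_coprime_forall_abs_mul_lt_sq hexc
    obtain ⟨s, hs, hsm, hsa, hsb, hle⟩ := hle k hk
    exact (hlt s hs hsm hsa hsb).not_ge hle

theorem exists_mul_one_add_sq_add_mul_eq {c σ γ : ℝ} (hc : c ≠ 0) (hσγ : σ ^ 2 + γ ^ 2 = 1)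
    (hcγ : 2 * c - 1 ≤ γ) (hγ : γ ≤ 2 * c + 1) : ∃ x, c * (1 + x ^ 2) + σ * x = γ := by
  have hdiscrim : 0 ≤ discrim c σ (c - γ) := by
    have : discrim c σ (c - γ) = (1 + γ - 2 * c) * (1 - γ + 2 * c) := by
      rw [discrim]
      linear_combination hσγ
    rw [this]
    exact mul_nonneg (by linarith) (by linarith)
  obtain ⟨x, hx⟩ := exists_quadratic_eq_zero hc ⟨_, (Real.mul_self_sqrt hdiscrim).symm⟩
  exact ⟨x, by linear_combination hx⟩

/-- The equation for the slope `x` of the starting point of the second copy under which its lines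
pass through vertices of the first copy; `a` and `b` are consecutive terms of `T` and `ψ` encodes
the choice of the index `d`. -/
def IsNestingRoot (m : ℕ) (a b ψ : ℤ) (x : ℝ) : Prop :=
  zcos m a * zcos m b * (1 + x ^ 2) + zsin m ψ * x = zcos m ψ

/-- Both roots of the quadratic equation for an isolated angle lie outside `i * rotField m`. -/
theorem exists_root_notMem_rotField {m : ℕ} {a b : ℤ} (ha : 0 < a) (hb : 0 < b)
    (ham : 2 * a < m) (hbm : 2 * b < m)
    (hle : ∀ k : ℕ, k.Coprime (2 * m) → ∃ s : ℤ, 0 < s ∧ 2 * s < m ∧ s ≠ a ∧ s ≠ b ∧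
      zcos m (k * s) ^ 2 ≤ |zcos m (k * a) * zcos m (k * b)|)
    (hge : ∃ s : ℤ, 0 < s ∧ 2 * s < m ∧ s ≠ a ∧ s ≠ b ∧
      zcos m a * zcos m b ≤ zcos m s ^ 2) :
    ∃ (ψ : ℤ) (x : ℝ), 2 ∣ ψ - (a + b) ∧ x * Complex.I ∉ rotField m ∧
      IsNestingRoot m a b ψ x := by
  obtain ⟨ψ, ⟨-, hpar, hψ⟩, hne⟩ := exists_isolated_angle ha hb ham hbm hle hge
  have hm : 0 < m := by lia
  have hpos : 0 < zcos m a * zcos m b :=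
    mul_pos (zcos_pos hm ha.le ham) (zcos_pos hm hb.le hbm)
  obtain ⟨x, hx⟩ := exists_mul_one_add_sq_add_mul_eq hpos.ne'
    ((add_comm _ _).trans (zcos_sq_add_zsin_sq m ψ)) (by linarith) (by linarith [zcos_le_one m ψ])
  refine ⟨ψ, x, hpar, fun hmem => ?_, hx⟩
  obtain ⟨n, hn⟩ := exists_zcos_add_zcos_eq hm (A := a + b) (B := b - a) (ψ := ψ) hmem
    (by rw [← two_mul_zcos_mul_zcos m a b]; linear_combination 2 * hx)
  exact hne n ((two_mul_zcos_mul_zcos m a b).trans hn)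

theorem prod_zcos_mul_eq {ι : Type*} [Fintype ι] {m : ℕ} (hm : 0 < m) {s t : ι → ℤ}
    (hst : ∏ i, zcos m (s i) = ∏ i, zcos m (t i)) {k : ℕ} (hk : k.Coprime (2 * m)) :
    ∏ i, zcos m (k * s i) = ∏ i, zcos m (k * t i) := by
  have hP := aeval_zcos_mul hm (N := Sum.elim s t)
    (P := ∏ i, MvPolynomial.X (Sum.inl i) - ∏ i, MvPolynomial.X (Sum.inr i))
    (by simp [hst]) hk
  simpa [sub_eq_zero] using hP

section

variable {ι : Type*} [Fintype ι] [Nonempty ι] {u : ι → ℝ} {c : ℝ}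

theorem exists_le_of_prod_le_pow (hc : 0 ≤ c) (hu : ∏ i, u i ≤ c ^ Fintype.card ι) :
    ∃ i, u i ≤ c := by
  by_contra! hlt
  refine hu.not_gt ?_
  rcases hc.eq_or_lt with rfl | hc
  · rw [zero_pow Fintype.card_ne_zero]
    exact Finset.prod_pos fun i _ => hlt i
  · simpa using Finset.prod_lt_prod_of_nonempty (f := fun _ => c) (fun _ _ => hc)
      (fun i _ => hlt i) Finset.univ_nonempty

theorem exists_le_of_pow_le_prod (hu0 : ∀ i, 0 < u i) (hu : c ^ Fintype.card ι ≤ ∏ i, u i) :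
    ∃ i, c ≤ u i := by
  by_contra! hlt
  refine hu.not_gt ?_
  simpa using Finset.prod_lt_prod_of_nonempty (g := fun _ => c) (fun i _ => hu0 i)
    (fun i _ => hlt i) Finset.univ_nonempty

end

theorem mul_succ_of_alternating {M : Type*} [CommMonoid M] {u : ℕ → M}
    (hu : ∀ j, u (j + 2) = u j) (j : ℕ) : u j * u (j + 1) = u 0 * u 1 := by
  induction j with
  | zero => rfl
  | succ j ih => rw [hu, mul_comm, ih]

theorem IsCelestialCohort.prod_zcos_eq {m h : ℕ} {s t : Fin h → ℕ}
    (hc : IsCelestialCohort m h (Finset.univ.val.map s) (Finset.univ.val.map t)) :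
    ∏ i, zcos m (s i) = ∏ i, zcos m (t i) := by
  have hcos := hc.cosine
  rw [Multiset.map_map, Multiset.map_map] at hcos
  simpa only [← ccos_eq_zcos] using! hcos

section

variable {h : ℕ} [NeZero h]

/-- The `h`-periodic sequence extending `s : Fin h → α`; it frees the index arithmetic of the vertex
and line classes from reductions modulo `h`. -/
def periodicExtension {α : Type*} (s : Fin h → α) (l : ℕ) : α := s (Fin.ofNat h l)

theorem periodicExtension_val {α : Type*} (s : Fin h → α) (i : Fin h) :
    periodicExtension s i = s i := by
  simp [periodicExtension]

theorem periodicExtension_succ {α : Type*} (s : Fin h → α) (l : ℕ) :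
    periodicExtension s (l + 1) = s (Fin.ofNat h l + 1) :=
  congrArg s (by ext; simp [Fin.val_add])

theorem periodicExtension_add_two {α : Type*} {s : Fin h → α} (hs : ∀ j, s (j + 2) = s j)
    (l : ℕ) : periodicExtension s (l + 2) = periodicExtension s l :=
  (congrArg s (by ext; change _ = (l % h + 2 % h) % h; simp)).trans (hs (Fin.ofNat h l))

theorem prod_sq_of_alternating {M : Type*} [CommMonoid M] {g : Fin h → M}
    (hg : ∀ j, g (j + 2) = g j) : (∏ i, g i) ^ 2 = (g 0 * g 1) ^ h := by
  have hmul (i : Fin h) : g i * g (i + 1) = g 0 * g 1 := by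
    have := mul_succ_of_alternating (periodicExtension_add_two hg) i
    rwa [periodicExtension_val, periodicExtension_succ, Fin.ofNat_val_eq_self] at this
  calc (∏ i, g i) ^ 2 = (∏ i, g i) * ∏ i, g (i + 1) := by
        rw [sq, ← Fintype.prod_equiv (Equiv.addRight 1) (fun i => g (i + 1)) g fun _ => rfl]
    _ = (g 0 * g 1) ^ h := by
        rw [← Finset.prod_mul_distrib, Finset.prod_congr rfl fun i _ => hmul i]
        simp

/-- The cosine condition and its conjugates exhibit, in each embedding, some `cos² s` below and
above the geometric mean `|cos t₀ * cos t₁|` of the `cos² t`. -/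
theorem exists_root_notMem_rotField_of_cohort {m : ℕ} {s t : Fin h → ℕ}
    (hc : IsCelestialCohort m h (Finset.univ.val.map s) (Finset.univ.val.map t))
    (hst : ∀ i j, s i ≠ t j) (ht : ∀ j, t (j + 2) = t j) :
    ∃ (ψ : ℤ) (x : ℝ), 2 ∣ ψ - (t 0 + t 1) ∧ x * Complex.I ∉ rotField m ∧
      IsNestingRoot m (t 0) (t 1) ψ x := by
  have hs (i) : 0 < s i ∧ 2 * s i < m := hc.left_range _ (by simp)
  have ht' (i) : 0 < t i ∧ 2 * t i < m := hc.right_range _ (by simp)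
  have hm : 0 < m := by have := hs 0; lia
  have hconj {k : ℕ} (hk : k.Coprime (2 * m)) : ∏ i, zcos m (k * s i) ^ 2 =
      (zcos m (k * t 0) * zcos m (k * t 1)) ^ Fintype.card (Fin h) := by
    rw [Finset.prod_pow, prod_zcos_mul_eq hm hc.prod_zcos_eq hk, Fintype.card_fin]
    exact prod_sq_of_alternating (g := fun i => zcos m (k * t i)) fun j => by rw [ht]
  refine exists_root_notMem_rotField (by grind) (by grind) (by grind) (by grind)
    (fun k hk => ?_) ?_
  · obtain ⟨i, hi⟩ := exists_le_of_prod_le_pow (abs_nonneg (zcos m (k * t 0) * zcos m (k * t 1)))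
      (u := fun i => zcos m (k * s i) ^ 2) (by
        rw [← abs_pow, ← hconj hk]
        exact le_abs_self _)
    exact ⟨s i, by grind, by grind, by grind, by grind, hi⟩
  · have hpos (i) : 0 < zcos m (s i) := zcos_pos hm (by lia) (by have := hs i; lia)
    obtain ⟨i, hi⟩ := exists_le_of_pow_le_prod (fun i => pow_pos (hpos i) 2)
      (by simpa using (hconj (Nat.coprime_one_left (2 * m))).ge)
    exact ⟨s i, by grind, by grind, by grind, by grind, hi⟩

end

/-- The radii of the vertex classes of a celestial construction started at `1`, for arbitrary
sequences of parameters. -/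
noncomputable def vertexRadius (m : ℕ) (s t : ℕ → ℕ) (j : ℕ) : ℝ :=
  ∏ l ∈ Finset.range j, zcos m (s l) / zcos m (t l)

/-- The polar angles, in units of `π / m`, of the vertices with index `0` of a celestial
construction started at `1`. -/
def vertexAngle (s t : ℕ → ℕ) (j : ℕ) : ℤ := ∑ l ∈ Finset.range j, ((s l : ℤ) - t l)

/-- The celestial vertices for sequences of parameters: `celestialVertex` without the reduction of
class indices modulo `h`. -/
noncomputable def vertex (m : ℕ) (s t : ℕ → ℕ) (z : ℂ) (j : ℕ) (i : ℤ) : ℂ :=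
  z * vertexRadius m s t j * rot m (2 * i + vertexAngle s t j)

/-- The celestial lines for sequences of parameters. -/
noncomputable def chord (m : ℕ) (s t : ℕ → ℕ) (z : ℂ) (j : ℕ) (i : ℤ) : AffineSubspace ℝ ℂ :=
  line[ℝ, vertex m s t z j i, vertex m s t z j (i + s j)]

/-- The distance from the centre to the lines of class `j` of a construction started at `1`. -/
noncomputable def chordDist (m : ℕ) (s t : ℕ → ℕ) (j : ℕ) : ℝ :=
  vertexRadius m s t j * zcos m (s j)

/-- The polar angle, in units of `π / m`, of the foot of the perpendicular from the centre to a line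
of a construction started at `1`. -/
def chordAngle (s t : ℕ → ℕ) (j : ℕ) (i : ℤ) : ℤ := 2 * i + vertexAngle s t j + s j

/-- The sequence without its first term. -/
def shift (s : ℕ → ℕ) (j : ℕ) : ℕ := s (j + 1)

/-- The point of the line `(L_0)_0` of a construction started at `1` at signed distance
`x cos (π s_0 / m)` from the foot of the perpendicular. -/
noncomputable def nestingStart (m : ℕ) (s : ℕ → ℕ) (x : ℝ) : ℂ :=
  zcos m (s 0) * rot m (s 0) * (1 + x * Complex.I)

theorem vertexRadius_succ (m : ℕ) (s t : ℕ → ℕ) (j : ℕ) :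
    vertexRadius m s t (j + 1) = vertexRadius m s t j * (zcos m (s j) / zcos m (t j)) :=
  Finset.prod_range_succ _ _

theorem vertexAngle_succ (s t : ℕ → ℕ) (j : ℕ) :
    vertexAngle s t (j + 1) = vertexAngle s t j + (s j - t j) :=
  Finset.sum_range_succ _ _

theorem vertexAngle_shift_add (s t : ℕ → ℕ) (j : ℕ) :
    vertexAngle (shift s) t j + s 0 = vertexAngle s t j + s j := by
  induction j with
  | zero => simp [vertexAngle]
  | succ j ih =>
    rw [vertexAngle_succ, vertexAngle_succ, shift]
    linear_combination ih

theorem vertexAngle_add_two (s t : ℕ → ℕ) (j : ℕ) :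
    vertexAngle s t (j + 2) =
      vertexAngle (shift s) t j + s 0 + shift s j - (t j + t (j + 1)) := by
  rw [vertexAngle_succ, vertexAngle_succ, vertexAngle_shift_add, shift]
  ring

theorem zcos_natCast_pos {m x : ℕ} (hx : 2 * x < m) : 0 < zcos m x :=
  zcos_pos (by lia) (by lia) (by lia)

theorem zsin_natCast_pos {m x : ℕ} (h0 : 0 < x) (hx : 2 * x < m) : 0 < zsin m x :=
  zsin_pos (by lia) (by lia) (by lia)

theorem mem_line_pair_iff {g A : ℂ} (hg : g ≠ 0) (hA : A.im ≠ 0) (p : ℂ) :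
    p ∈ line[ℝ, g * conj A, g * A] ↔ (p / g).re = A.re := by
  obtain ⟨q, rfl⟩ : ∃ q, p = g * q := ⟨p / g, by field_simp⟩
  have hlineMap (r : ℝ) : AffineMap.lineMap (g * conj A) (g * A) r =
      g * (conj A + r * (A - conj A)) := by
    rw [AffineMap.lineMap_apply, vsub_eq_sub, vadd_eq_add, Complex.real_smul]
    ring
  simp only [mem_affineSpan_pair_iff_exists_lineMap_eq, hlineMap, mul_right_inj' hg,
    mul_div_cancel_left₀ q hg]
  constructor
  · rintro ⟨r, rfl⟩
    simp
  · intro h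
    refine ⟨(q.im / A.im + 1) / 2, Complex.ext (by simp [h]) ?_⟩
    simp
    field_simp
    ring

theorem one_add_mul_I_ne_zero (x : ℝ) : 1 + x * Complex.I ≠ 0 := fun h => by
  simpa using congrArg Complex.re h

theorem rot_mul_one_add_mul_I_re (m : ℕ) (N : ℤ) (x : ℝ) :
    (rot m N * (1 + x * Complex.I)).re = zcos m N - zsin m N * x := by
  simp [rot_re, rot_im]

theorem rot_div_one_add_mul_I_re (m : ℕ) (N : ℤ) (x : ℝ) :
    (rot m N / (1 + x * Complex.I)).re = (zcos m N + zsin m N * x) / (1 + x ^ 2) := by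
  have hnormSq : Complex.normSq (1 + x * Complex.I) = 1 + x ^ 2 := by
    simp [Complex.normSq_apply, sq]
  rw [Complex.div_re, hnormSq]
  simp [rot_re, rot_im, add_div]

section

variable {m : ℕ} {s t : ℕ → ℕ} (ht : ∀ j, 2 * t j < m)
include ht

theorem zcos_mul_vertexRadius_shift (j : ℕ) :
    zcos m (s 0) * vertexRadius m (shift s) t j = chordDist m s t j := by
  induction j with
  | zero => simp [chordDist, vertexRadius]
  | succ j ih =>
    have := zcos_natCast_pos (ht j)
    rw [chordDist, vertexRadius_succ, vertexRadius_succ, ← mul_assoc, ih, chordDist, shift]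
    field_simp

theorem chordDist_shift_mul_zcos (j : ℕ) :
    chordDist m (shift s) t j * zcos m (s 0) =
      vertexRadius m s t (j + 2) * (zcos m (t j) * zcos m (t (j + 1))) := by
  have := zcos_natCast_pos (ht j)
  have := zcos_natCast_pos (ht (j + 1))
  rw [chordDist, mul_right_comm, mul_comm (vertexRadius _ _ _ _), zcos_mul_vertexRadius_shift ht,
    vertexRadius_succ, vertexRadius_succ, chordDist, shift]
  field_simp

/-- The second copy arises from the feet of the perpendiculars to the lines of the first copy by a
common spiral similarity. -/
theorem vertex_shift_nestingStart (x : ℝ) (j : ℕ) (i : ℤ) :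
    vertex m (shift s) t (nestingStart m s x) j i =
      chordDist m s t j * rot m (chordAngle s t j i) * (1 + x * Complex.I) := by
  have hangle : chordAngle s t j i = s 0 + (2 * i + vertexAngle (shift s) t j) := by
    rw [chordAngle]
    linear_combination -vertexAngle_shift_add s t j
  rw [vertex, nestingStart, ← zcos_mul_vertexRadius_shift ht, hangle, rot_add m (s 0)]
  push_cast
  ring

variable (hs : ∀ j, 0 < s j ∧ 2 * s j < m)
include hs

theorem vertexRadius_pos (j : ℕ) : 0 < vertexRadius m s t j :=
  Finset.prod_pos fun l _ => div_pos (zcos_natCast_pos (hs l).2) (zcos_natCast_pos (ht l))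

theorem chordDist_pos (j : ℕ) : 0 < chordDist m s t j :=
  mul_pos (vertexRadius_pos ht hs j) (zcos_natCast_pos (hs j).2)

theorem mem_chord_iff {z : ℂ} (hz : z ≠ 0) (j : ℕ) (i : ℤ) (p : ℂ) :
    p ∈ chord m s t z j i ↔
      (rot m (-chordAngle s t j i) * (p / z)).re = chordDist m s t j := by
  have hr := vertexRadius_pos ht hs j
  have hsin := zsin_natCast_pos (hs j).1 (hs j).2
  have hmem := mem_line_pair_iff (g := z * rot m (chordAngle s t j i))
    (A := vertexRadius m s t j * rot m (s j)) (mul_ne_zero hz (rot_ne_zero _ _))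
    (by simpa [rot_im] using ⟨hr.ne', hsin.ne'⟩) p
  have hleft : z * rot m (chordAngle s t j i) * conj (vertexRadius m s t j * rot m (s j)) =
      vertex m s t z j i := by
    rw [map_mul, conj_rot, Complex.conj_ofReal, vertex,
      show 2 * i + vertexAngle s t j = chordAngle s t j i + -s j by rw [chordAngle]; ring,
      rot_add]
    ring
  have hright : z * rot m (chordAngle s t j i) * (vertexRadius m s t j * rot m (s j)) =
      vertex m s t z j (i + s j) := by
    rw [vertex, show 2 * (i + s j) + vertexAngle s t j = chordAngle s t j i + s j by
      rw [chordAngle]; ring, rot_add]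
    ring
  rw [hleft, hright, Complex.re_ofReal_mul, rot_re] at hmem
  rw [chord, hmem, chordDist, rot_neg, ← div_eq_inv_mul, div_div]

theorem chord_eq_chord {z : ℂ} (hz : z ≠ 0) {j k : ℕ} {i l : ℤ}
    (hdist : chordDist m s t j = chordDist m s t k)
    (hangle : rot m (chordAngle s t j i) = rot m (chordAngle s t k l)) :
    chord m s t z j i = chord m s t z k l := by
  ext p
  rw [mem_chord_iff ht hs hz, mem_chord_iff ht hs hz, hdist, rot_neg, rot_neg, hangle]

omit ht in
theorem nestingStart_ne_zero (x : ℝ) : nestingStart m s x ≠ 0 :=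
  mul_ne_zero (mul_ne_zero (by exact_mod_cast (zcos_natCast_pos (hs 0).2).ne') (rot_ne_zero _ _))
    (one_add_mul_I_ne_zero x)

theorem mem_chord_zero_iff (w : ℂ) :
    w ∈ chord m s t 1 0 0 ↔ ∃ x : ℝ, w = nestingStart m s x := by
  have hcos := (zcos_natCast_pos (hs 0).2).ne'
  obtain ⟨q, rfl⟩ : ∃ q, w = rot m (s 0) * q := ⟨w / rot m (s 0), by
    field_simp [rot_ne_zero m (s 0)]⟩
  have hangle : chordAngle s t 0 0 = s 0 := by simp [chordAngle, vertexAngle]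
  have hdist : chordDist m s t 0 = zcos m (s 0) := by simp [chordDist, vertexRadius]
  rw [mem_chord_iff ht hs one_ne_zero, hangle, hdist, rot_neg, div_one,
    inv_mul_cancel_left₀ (rot_ne_zero _ _)]
  simp only [nestingStart, mul_comm ((zcos m (s 0) : ℝ) : ℂ), mul_assoc,
    mul_right_inj' (rot_ne_zero m (s 0))]
  constructor
  · intro h
    refine ⟨q.im / zcos m (s 0), Complex.ext (by simp [h]) ?_⟩
    simp
    field_simp
  · rintro ⟨x, rfl⟩
    simp

theorem vertex_shift_mem_chord_iff (x : ℝ) (j k : ℕ) (i l : ℤ) :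
    vertex m (shift s) t (nestingStart m s x) j i ∈ chord m s t 1 k l ↔
      chordDist m s t j * (zcos m (chordAngle s t j i - chordAngle s t k l) -
        zsin m (chordAngle s t j i - chordAngle s t k l) * x) = chordDist m s t k := by
  rw [mem_chord_iff ht hs one_ne_zero, div_one, vertex_shift_nestingStart ht,
    ← rot_mul_one_add_mul_I_re, ← Complex.re_ofReal_mul, rot_sub, rot_neg]
  ring_nf

theorem vertex_mem_chord_shift_iff (x : ℝ) {j k : ℕ} {i l ψ : ℤ}
    (hψ : ψ = chordAngle (shift s) t j l + s 0 - (2 * i + vertexAngle s t k)) :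
    vertex m s t 1 k i ∈ chord m (shift s) t (nestingStart m s x) j l ↔
      vertexRadius m s t k * (zcos m ψ - zsin m ψ * x) =
        chordDist m (shift s) t j * zcos m (s 0) * (1 + x ^ 2) := by
  have hcos := zcos_natCast_pos (hs 0).2
  have : 0 < 1 + x ^ 2 := by positivity
  have hquot : rot m (-chordAngle (shift s) t j l) * (vertex m s t 1 k i / nestingStart m s x) =
      ((vertexRadius m s t k / zcos m (s 0) : ℝ) : ℂ) *
        (rot m (-ψ) / (1 + x * Complex.I)) := by
    rw [vertex, nestingStart, hψ, neg_sub, rot_sub, rot_add m _ (s 0 : ℤ), rot_neg]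
    generalize 1 + x * Complex.I = g
    push_cast
    ring
  rw [mem_chord_iff (s := shift s) ht (fun j => hs (j + 1)) (nestingStart_ne_zero hs x), hquot,
    Complex.re_ofReal_mul, rot_div_one_add_mul_I_re, zcos_neg, zsin_neg, div_mul_div_comm,
    div_eq_iff (by positivity)]
  ring_nf

end

section

variable {α β : Type*}

theorem ncard_setOf_eq_one_iff {p : α → Prop} : {x | p x}.ncard = 1 ↔ ∃! x, p x :=
  Set.ncard_eq_one.trans Set.singleton_iff_unique_mem

theorem ncard_sep_union {A B : Set α} (hA : A.Finite) (hB : B.Finite) (h : Disjoint A B)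
    (p : α → Prop) :
    {x | x ∈ A ∪ B ∧ p x}.ncard = {x | x ∈ A ∧ p x}.ncard + {x | x ∈ B ∧ p x}.ncard := by
  rw [← Set.ncard_union_eq (h.mono (Set.sep_subset A p) (Set.sep_subset B p))
    (hA.subset (Set.sep_subset A p)) (hB.subset (Set.sep_subset B p))]
  exact congrArg Set.ncard Set.sep_union

theorem ncard_sep_image {f : α → β} (hf : Function.Injective f) (A : Set α) (p : β → Prop) :
    {y | y ∈ f '' A ∧ p y}.ncard = {x | x ∈ A ∧ p (f x)}.ncard := by
  rw [← Set.ncard_image_of_injective _ hf]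
  exact congrArg Set.ncard (Set.image_inter_preimage f A {y | p y}).symm

theorem disjoint_of_ncard_union_eq {A B : Set α} (hA : A.Finite) (hB : B.Finite)
    (h : (A ∪ B).ncard = A.ncard + B.ncard) : Disjoint A B := by
  have hinter := Set.ncard_union_add_ncard_inter A B hA hB
  rw [Set.disjoint_iff_inter_eq_empty, ← Set.ncard_eq_zero (hA.inter_of_left B)]
  lia

theorem existsUnique_of_forall_existsUnique {r : α → β → Prop} {A : Set α} {B : Set β}
    (hA : A.Finite) (hcard : A.ncard ≤ B.ncard) (hAB : ∀ a ∈ A, ∃! b, b ∈ B ∧ r a b)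
    (hBA : ∀ b ∈ B, ∃ a ∈ A, r a b) {b : β} (hb : b ∈ B) : ∃! a, a ∈ A ∧ r a b := by
  have : Nonempty β := ⟨b⟩
  choose! f hf hunique using hAB
  obtain ⟨a, ha, hab⟩ := hBA b hb
  refine ⟨a, ⟨ha, hab⟩, fun a' ⟨ha', hab'⟩ => ?_⟩
  exact Set.inj_on_of_surj_on_of_ncard_le (s := A) (t := B) (fun a _ => f a)
    (fun a ha => (hf a ha).1)
    (fun b hb => let ⟨a, ha, hab⟩ := hBA b hb; ⟨a, ha, (hunique a ha b ⟨hb, hab⟩).symm⟩)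
    hcard ha' ha ((hunique a' ha' b ⟨hb, hab'⟩).symm.trans (hunique a ha b ⟨hb, hab⟩)) hA

end

namespace IsGeometricConfiguration

variable {n k : ℕ} {P P₁ P₂ : Set ℂ} {L L₁ L₂ : Set (AffineSubspace ℝ ℂ)}

theorem union (h₁ : IsGeometricConfiguration n k P₁ L₁) (h₂ : IsGeometricConfiguration n k P₂ L₂)
    (hP : Disjoint P₁ P₂) (hL : Disjoint L₁ L₂)
    (hP₁ : ∀ p ∈ P₁, ∃! l, l ∈ L₂ ∧ p ∈ l) (hP₂ : ∀ p ∈ P₂, ∃! l, l ∈ L₁ ∧ p ∈ l)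
    (hL₁ : ∀ l ∈ L₁, ∃ p ∈ P₂, p ∈ l) (hL₂ : ∀ l ∈ L₂, ∃ p ∈ P₁, p ∈ l) :
    IsGeometricConfiguration (2 * n) (k + 1) (P₁ ∪ P₂) (L₁ ∪ L₂) where
  finite_points := h₁.finite_points.union h₂.finite_points
  finite_lines := h₁.finite_lines.union h₂.finite_lines
  card_points := by
    rw [Set.ncard_union_eq hP h₁.finite_points h₂.finite_points, h₁.card_points,
      h₂.card_points, two_mul]
  card_lines := by
    rw [Set.ncard_union_eq hL h₁.finite_lines h₂.finite_lines, h₁.card_lines,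
      h₂.card_lines, two_mul]
  isLine l hl := hl.elim (h₁.isLine l) (h₂.isLine l)
  line_incidences l hl := by
    rw [ncard_sep_union h₁.finite_points h₂.finite_points hP]
    rcases hl with hl | hl
    · rw [h₁.line_incidences l hl, ncard_setOf_eq_one_iff.2
        (existsUnique_of_forall_existsUnique h₂.finite_points
          (h₂.card_points.trans h₁.card_lines.symm).le hP₂ hL₁ hl)]
    · rw [h₂.line_incidences l hl, add_comm, ncard_setOf_eq_one_iff.2
        (existsUnique_of_forall_existsUnique h₁.finite_points
          (h₁.card_points.trans h₂.card_lines.symm).le hP₁ hL₂ hl)]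
  point_incidences p hp := by
    rw [ncard_sep_union h₁.finite_lines h₂.finite_lines hL]
    rcases hp with hp | hp
    · rw [h₁.point_incidences p hp, ncard_setOf_eq_one_iff.2 (hP₁ p hp)]
    · rw [h₂.point_incidences p hp, ncard_setOf_eq_one_iff.2 (hP₂ p hp), add_comm]

theorem union_of_ncard_le (h₁ : IsGeometricConfiguration n k P₁ L₁)
    (h₂ : IsGeometricConfiguration n k P₂ L₂) (hP : (P₁ ∪ P₂).ncard = 2 * n)
    (hL : (L₁ ∪ L₂).ncard = 2 * n)
    (hle : ∀ p ∈ P₁ ∪ P₂, {l | l ∈ L₁ ∪ L₂ ∧ p ∈ l}.ncard ≤ k + 1)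
    (hP₁ : ∀ p ∈ P₁, ∃ l ∈ L₂, p ∈ l) (hP₂ : ∀ p ∈ P₂, ∃ l ∈ L₁, p ∈ l)
    (hL₁ : ∀ l ∈ L₁, ∃ p ∈ P₂, p ∈ l) (hL₂ : ∀ l ∈ L₂, ∃ p ∈ P₁, p ∈ l) :
    IsGeometricConfiguration (2 * n) (k + 1) (P₁ ∪ P₂) (L₁ ∪ L₂) := by
  have hPd := disjoint_of_ncard_union_eq h₁.finite_points h₂.finite_points
    (by rw [hP, h₁.card_points, h₂.card_points, two_mul])
  have hLd := disjoint_of_ncard_union_eq h₁.finite_lines h₂.finite_lines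
    (by rw [hL, h₁.card_lines, h₂.card_lines, two_mul])
  simp only [ncard_sep_union h₁.finite_lines h₂.finite_lines hLd] at hle
  refine h₁.union h₂ hPd hLd (fun p hp => ?_) (fun p hp => ?_) hL₁ hL₂
  · have hpos := (Set.ncard_pos (h₂.finite_lines.subset (Set.sep_subset L₂ (p ∈ ·)))).2 (hP₁ p hp)
    have hsum := hle p (Or.inl hp)
    rw [h₁.point_incidences p hp] at hsum
    exact ncard_setOf_eq_one_iff.1 (le_antisymm (by lia) hpos)
  · have hpos := (Set.ncard_pos (h₁.finite_lines.subset (Set.sep_subset L₁ (p ∈ ·)))).2 (hP₂ p hp)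
    have hsum := hle p (Or.inr hp)
    rw [h₂.point_incidences p hp] at hsum
    exact ncard_setOf_eq_one_iff.1 (le_antisymm (by lia) hpos)

theorem union_of_existsUnique (hk : k ≠ 1) (h₁ : IsGeometricConfiguration n k P₁ L₁)
    (h₂ : IsGeometricConfiguration n k P₂ L₂)
    (hP₁ : ∀ p ∈ P₁, ∃! l, l ∈ L₂ ∧ p ∈ l) (hP₂ : ∀ p ∈ P₂, ∃! l, l ∈ L₁ ∧ p ∈ l)
    (hL₁ : ∀ l ∈ L₁, ∃ p ∈ P₂, p ∈ l) (hL₂ : ∀ l ∈ L₂, ∃ p ∈ P₁, p ∈ l) :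
    IsGeometricConfiguration (2 * n) (k + 1) (P₁ ∪ P₂) (L₁ ∪ L₂) := by
  refine h₁.union h₂ (Set.disjoint_left.2 fun p hp hp' => hk ?_)
    (Set.disjoint_left.2 fun l hl hl' => hk ?_) hP₁ hP₂ hL₁ hL₂
  · rw [← h₁.point_incidences p hp]
    exact ncard_setOf_eq_one_iff.2 (hP₂ p hp')
  · rw [← h₁.line_incidences l hl]
    exact ncard_setOf_eq_one_iff.2 (existsUnique_of_forall_existsUnique h₁.finite_points
      (h₁.card_points.trans h₂.card_lines.symm).le hP₁ hL₂ hl')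

theorem map (h : IsGeometricConfiguration n k P L) (e : ℂ ≃ᵃ[ℝ] ℂ) :
    IsGeometricConfiguration n k (e '' P) (AffineSubspace.map (e : ℂ →ᵃ[ℝ] ℂ) '' L) := by
  have hmem (p : ℂ) (l : AffineSubspace ℝ ℂ) : e p ∈ l.map (e : ℂ →ᵃ[ℝ] ℂ) ↔ p ∈ l :=
    AffineSubspace.mem_map_iff_mem_of_injective e.injective
  have hinj : Function.Injective (AffineSubspace.map (e : ℂ →ᵃ[ℝ] ℂ)) := fun l l' hl => by
    ext p
    rw [← hmem, hl, hmem]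
  refine ⟨h.finite_points.image _, h.finite_lines.image _, ?_, ?_, ?_, ?_, ?_⟩
  · rw [Set.ncard_image_of_injective _ e.injective, h.card_points]
  · rw [Set.ncard_image_of_injective _ hinj, h.card_lines]
  · rintro _ ⟨l, hl, rfl⟩
    rw [AffineSubspace.map_direction, ← h.isLine l hl]
    exact LinearEquiv.finrank_map_eq e.linear _
  · rintro _ ⟨l, hl, rfl⟩
    simpa only [ncard_sep_image e.injective, hmem] using h.line_incidences l hl
  · rintro _ ⟨p, hp, rfl⟩
    simpa only [ncard_sep_image hinj, hmem] using h.point_incidences p hp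

theorem celestial_of_ne_zero {m h : ℕ} {s t : Fin h → ℕ}
    {z w : ℂ} (hc : IsGeometricConfiguration n k (celestialPoints m s t z) (celestialLines m s t z))
    (hz : z ≠ 0) (hw : w ≠ 0) :
    IsGeometricConfiguration n k (celestialPoints m s t w) (celestialLines m s t w) := by
  let e : ℂ ≃ᵃ[ℝ] ℂ :=
    ((LinearEquiv.smulOfNeZero ℂ ℂ (w / z) (div_ne_zero hw hz)).restrictScalars ℝ).toAffineEquiv
  have hvertex (j i) : celestialVertex m s t w j i = e (celestialVertex m s t z j i) := by
    change celestialVertex m s t w j i = w / z * celestialVertex m s t z j i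
    simp only [celestialVertex]
    field_simp
  have hline (j i) : celestialLine m s t w j i =
      (celestialLine m s t z j i).map (e : ℂ →ᵃ[ℝ] ℂ) := by
    rw [celestialLine, celestialLine, AffineSubspace.map_span, Set.image_pair, hvertex, hvertex]
    rfl
  convert hc.map e using 1
  · ext p
    simp only [celestialPoints, Set.mem_ofPred_eq, hvertex]
    exact ⟨fun ⟨j, i, hp⟩ => ⟨_, ⟨j, i, rfl⟩, hp.symm⟩,
      fun ⟨_, ⟨j, i, hq⟩, hp⟩ => ⟨j, i, by rw [← hp, hq]⟩⟩
  · ext l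
    simp only [celestialLines, Set.mem_ofPred_eq, hline]
    exact ⟨fun ⟨j, i, hl⟩ => ⟨_, ⟨j, i, rfl⟩, hl.symm⟩,
      fun ⟨_, ⟨j, i, hl'⟩, hl⟩ => ⟨j, i, by rw [← hl, hl']⟩⟩

end IsGeometricConfiguration

theorem eq_and_rot_eq_of_notMem_rotField {m : ℕ} {x : ℝ} (hx : x * Complex.I ∉ rotField m)
    {r u : ℝ} (hr : 0 < r) (hu : 0 < u) (hrK : (r : ℂ) ∈ rotField m) (huK : (u : ℂ) ∈ rotField m)
    {M N : ℤ} (h : r * (zcos m M - zsin m M * x) = u * (zcos m N - zsin m N * x)) :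
    r = u ∧ rot m M = rot m N := by
  set α := r * zcos m M - u * zcos m N with hα
  set β := r * zsin m M - u * zsin m N with hβ
  have hαβ : α = β * x := by linear_combination h
  have hre : ((r * rot m M - u * rot m N : ℂ)).re = α := by simp [rot_re, hα]
  have him : ((r * rot m M - u * rot m N : ℂ)).im = β := by simp [rot_im, hβ]
  have hsum : (r * rot m M - u * rot m N : ℂ) = α + β * Complex.I := by
    rw [← hre, ← him, Complex.re_add_im]
  have hαK : (α : ℂ) ∈ rotField m := by
    rw [hα]
    push_cast
    exact sub_mem (mul_mem hrK (zcos_mem_rotField m M)) (mul_mem huK (zcos_mem_rotField m N))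
  have hβK : (β : ℂ) * Complex.I ∈ rotField m := by
    rw [← sub_eq_iff_eq_add'.2 hsum]
    exact sub_mem (sub_mem (mul_mem hrK (rot_mem_rotField m M))
      (mul_mem huK (rot_mem_rotField m N))) hαK
  have hβ0 : β = 0 := by
    by_contra hβ0
    have hβ0' : (β : ℂ) ≠ 0 := by exact_mod_cast hβ0
    refine hx ?_
    rw [show (x : ℂ) * Complex.I = -(α / (β * Complex.I)) by
      rw [hαβ]
      push_cast
      field_simp
      simp]
    exact neg_mem (div_mem hαK hβK)
  have hrot : (r : ℂ) * rot m M = u * rot m N := by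
    rw [← sub_eq_zero, hsum, hαβ, hβ0]
    simp
  have hru : r = u := by
    simpa [norm_rot, abs_of_pos, hr, hu] using congrArg norm hrot
  subst hru
  exact ⟨rfl, mul_left_cancel₀ (by exact_mod_cast hr.ne') hrot⟩

theorem vertexRadius_mem_rotField (m : ℕ) (s t : ℕ → ℕ) (j : ℕ) :
    (vertexRadius m s t j : ℂ) ∈ rotField m := by
  rw [vertexRadius]
  push_cast
  exact prod_mem fun l _ => div_mem (zcos_mem_rotField m _) (zcos_mem_rotField m _)

theorem chordDist_mem_rotField (m : ℕ) (s t : ℕ → ℕ) (j : ℕ) :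
    (chordDist m s t j : ℂ) ∈ rotField m := by
  rw [chordDist]
  push_cast
  exact mul_mem (vertexRadius_mem_rotField m s t j) (zcos_mem_rotField m _)

/-- The points of the celestial construction for sequences of parameters. -/
def vertexSet (m : ℕ) (s t : ℕ → ℕ) (z : ℂ) : Set ℂ := {p | ∃ j i, p = vertex m s t z j i}

/-- The lines of the celestial construction for sequences of parameters. -/
def chordSet (m : ℕ) (s t : ℕ → ℕ) (z : ℂ) : Set (AffineSubspace ℝ ℂ) :=
  {l | ∃ j i, l = chord m s t z j i}

section

variable {m : ℕ} {s t : ℕ → ℕ} (ht : ∀ j, 2 * t j < m) (hs : ∀ j, 0 < s j ∧ 2 * s j < m)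
include ht hs

theorem vertex_shift_mem_chord (x : ℝ) (j : ℕ) (i : ℤ) :
    vertex m (shift s) t (nestingStart m s x) j i ∈ chord m s t 1 j i := by
  rw [vertex_shift_mem_chord_iff ht hs, sub_self, zcos_zero, zsin_zero]
  ring

theorem existsUnique_mem_chordSet {x : ℝ} (hx : x * Complex.I ∉ rotField m) {p : ℂ}
    (hp : p ∈ vertexSet m (shift s) t (nestingStart m s x)) :
    ∃! l, l ∈ chordSet m s t 1 ∧ p ∈ l := by
  obtain ⟨j, i, rfl⟩ := hp
  refine ⟨chord m s t 1 j i, ⟨⟨j, i, rfl⟩, vertex_shift_mem_chord ht hs x j i⟩, ?_⟩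
  rintro _ ⟨⟨k, l, rfl⟩, hmem⟩
  rw [vertex_shift_mem_chord_iff ht hs] at hmem
  obtain ⟨hdist, hrot⟩ := eq_and_rot_eq_of_notMem_rotField (N := 0) hx (chordDist_pos ht hs j)
    (chordDist_pos ht hs k) (chordDist_mem_rotField m s t j) (chordDist_mem_rotField m s t k)
    (by rw [hmem, zcos_zero, zsin_zero]; ring)
  refine chord_eq_chord ht hs one_ne_zero hdist.symm ?_
  rw [rot_sub, rot_zero, div_eq_one_iff_eq (rot_ne_zero _ _)] at hrot
  exact hrot.symm

theorem chordDist_eq_and_rot_eq_of_vertex_mem_chord_shift {x : ℝ} (hx : x * Complex.I ∉ rotField m)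
    {ψ : ℤ} (hroot : IsNestingRoot m (t 0) (t 1) ψ x) {j k : ℕ} {i l : ℤ}
    (hmem : vertex m s t 1 k i ∈ chord m (shift s) t (nestingStart m s x) j l) :
    chordDist m (shift s) t j * zcos m (s 0) =
        vertexRadius m s t k * (zcos m (t 0) * zcos m (t 1)) ∧
      rot m (chordAngle (shift s) t j l) = rot m (ψ + (2 * i + vertexAngle s t k) - s 0) := by
  have hcos : 0 < zcos m (t 0) * zcos m (t 1) :=
    mul_pos (zcos_natCast_pos (ht 0)) (zcos_natCast_pos (ht 1))
  have hcosK : ((zcos m (t 0) * zcos m (t 1) : ℝ) : ℂ) ∈ rotField m := by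
    push_cast
    exact mul_mem (zcos_mem_rotField m _) (zcos_mem_rotField m _)
  obtain ⟨N, hN⟩ : ∃ N, N = chordAngle (shift s) t j l + s 0 - (2 * i + vertexAngle s t k) :=
    ⟨_, rfl⟩
  rw [vertex_mem_chord_shift_iff ht hs x hN] at hmem
  obtain ⟨hdist, hrot⟩ := eq_and_rot_eq_of_notMem_rotField (M := N) (N := ψ)
    (r := vertexRadius m s t k * (zcos m (t 0) * zcos m (t 1)))
    (u := chordDist m (shift s) t j * zcos m (s 0)) hx (mul_pos (vertexRadius_pos ht hs k) hcos)
    (mul_pos (chordDist_pos (s := shift s) ht (fun j => hs (j + 1)) j)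
      (zcos_natCast_pos (hs 0).2))
    (by rw [Complex.ofReal_mul]; exact mul_mem (vertexRadius_mem_rotField m s t k) hcosK)
    (by
      rw [Complex.ofReal_mul]
      exact mul_mem (chordDist_mem_rotField m _ t j) (zcos_mem_rotField m _))
    (by
      rw [IsNestingRoot] at hroot
      linear_combination zcos m (t 0) * zcos m (t 1) * hmem +
        chordDist m (shift s) t j * zcos m (s 0) * hroot)
  refine ⟨hdist.symm, ?_⟩
  rw [rot_sub, rot_add m ψ, ← hrot, hN, rot_sub, rot_add m _ (s 0)]
  field_simp [rot_ne_zero]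

theorem existsUnique_mem_chordSet_shift {x : ℝ} (hx : x * Complex.I ∉ rotField m) {ψ : ℤ}
    (hroot : IsNestingRoot m (t 0) (t 1) ψ x) {p : ℂ} (hp : p ∈ vertexSet m s t 1)
    (hex : ∃ l ∈ chordSet m (shift s) t (nestingStart m s x), p ∈ l) :
    ∃! l, l ∈ chordSet m (shift s) t (nestingStart m s x) ∧ p ∈ l := by
  obtain ⟨k, i, rfl⟩ := hp
  obtain ⟨_, ⟨j, l, rfl⟩, hmem⟩ := hex
  refine ⟨_, ⟨⟨j, l, rfl⟩, hmem⟩, ?_⟩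
  rintro _ ⟨⟨j', l', rfl⟩, hmem'⟩
  obtain ⟨hdist, hrot⟩ := chordDist_eq_and_rot_eq_of_vertex_mem_chord_shift ht hs hx hroot hmem
  obtain ⟨hdist', hrot'⟩ := chordDist_eq_and_rot_eq_of_vertex_mem_chord_shift ht hs hx hroot hmem'
  exact chord_eq_chord ht (fun j => hs (j + 1)) (nestingStart_ne_zero hs x)
    (mul_right_cancel₀ (zcos_natCast_pos (hs 0).2).ne' (hdist'.trans hdist.symm))
    (hrot'.trans hrot.symm)

variable (ht2 : ∀ j, t (j + 2) = t j)
include ht2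

theorem vertex_add_two_mem_chord_shift_iff (x : ℝ) (j : ℕ) (i e : ℤ) :
    vertex m s t 1 (j + 2) (i + e) ∈ chord m (shift s) t (nestingStart m s x) j i ↔
      IsNestingRoot m (t 0) (t 1) (t 0 + t 1 - 2 * e) x := by
  have hsum : (t j + t (j + 1) : ℤ) = t 0 + t 1 :=
    congrArg Multiplicative.toAdd
      (mul_succ_of_alternating (u := fun j => Multiplicative.ofAdd (t j : ℤ))
        (fun j => by rw [ht2]) j)
  have hprod : zcos m (t j) * zcos m (t (j + 1)) = zcos m (t 0) * zcos m (t 1) :=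
    mul_succ_of_alternating (u := fun j => zcos m (t j)) (fun j => by rw [ht2]) j
  rw [vertex_mem_chord_shift_iff ht hs x (ψ := t 0 + t 1 - 2 * e) (by
      rw [vertexAngle_add_two, chordAngle, ← hsum]
      ring),
    chordDist_shift_mul_zcos ht, hprod, mul_assoc (vertexRadius _ _ _ _),
    mul_right_inj' (vertexRadius_pos ht hs _).ne', IsNestingRoot]
  exact ⟨fun h => by linear_combination -h, fun h => by linear_combination -h⟩

end

theorem dist_mul_eq_dist_zero_iff {g : ℂ} (hg : g ≠ 0) (a u : ℂ) :
    dist (g * a) (g * u) = dist 0 (g * u) ↔ Complex.normSq a = 2 * (a * conj u).re := by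
  rw [dist_eq_norm, dist_eq_norm, ← mul_sub, zero_sub, norm_neg, norm_mul, norm_mul,
    mul_right_inj' (norm_ne_zero_iff.2 hg), ← sq_eq_sq₀ (norm_nonneg _) (norm_nonneg _),
    ← Complex.normSq_eq_norm_sq, ← Complex.normSq_eq_norm_sq, Complex.normSq_sub]
  exact ⟨fun h => by linear_combination h, fun h => by linear_combination h⟩

/-- Inversion in the unit circle takes the circle to the line through `conj A` and `A`. -/
theorem cospherical_conj_iff {A g y : ℂ} (hA : Complex.normSq A = 1) (hre : A.re ≠ 0)
    (him : A.im ≠ 0) (hg : g ≠ 0) (hy : y ≠ 0) :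
    EuclideanGeometry.Cospherical ({g * A, 0, g * conj A, g * y} : Set ℂ) ↔
      (y⁻¹).re = A.re := by
  rw [Complex.inv_re, div_eq_iff (Complex.normSq_pos.2 hy).ne']
  constructor
  · rintro ⟨o, ρ, ho⟩
    obtain ⟨u, rfl⟩ : ∃ u, o = g * u := ⟨o / g, by field_simp⟩
    have hpoint {a : ℂ} (ha : dist (g * a) (g * u) = ρ) :
        Complex.normSq a = 2 * (a * conj u).re :=
      (dist_mul_eq_dist_zero_iff hg a u).1 (ha.trans (ho 0 (by simp)).symm)
    have hpos := hpoint (ho (g * A) (by simp))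
    have hneg := hpoint (ho (g * conj A) (by simp))
    have hpoint_y := hpoint (ho (g * y) (by simp))
    rw [hA, Complex.mul_re, Complex.conj_re, Complex.conj_im] at hpos
    rw [Complex.normSq_conj, hA, Complex.mul_re, Complex.conj_re, Complex.conj_re,
      Complex.conj_im, Complex.conj_im] at hneg
    rw [Complex.mul_re, Complex.conj_re, Complex.conj_im] at hpoint_y
    have hu : u.im = 0 := by
      simpa [him] using show A.im * u.im = 0 by linear_combination (hneg - hpos) / 4
    rw [hu] at hpos hpoint_y
    linear_combination y.re * hpos - A.re * hpoint_y
  · intro h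
    refine ⟨g * (1 / (2 * A.re) : ℝ), dist 0 (g * (1 / (2 * A.re) : ℝ)), ?_⟩
    rintro p (rfl | rfl | rfl | rfl)
    · rw [dist_mul_eq_dist_zero_iff hg, hA, Complex.conj_ofReal, Complex.re_mul_ofReal]
      field_simp
    · rfl
    · rw [dist_mul_eq_dist_zero_iff hg, Complex.normSq_conj, hA, Complex.conj_ofReal,
        Complex.re_mul_ofReal, Complex.conj_re]
      field_simp
    · rw [dist_mul_eq_dist_zero_iff hg, Complex.conj_ofReal, Complex.re_mul_ofReal, h]
      field_simp

theorem cospherical_vertex_iff {m : ℕ} {s t : ℕ → ℕ} (ht : ∀ j, 2 * t j < m)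
    (hs : ∀ j, 0 < s j ∧ 2 * s j < m) {w : ℂ} (hw : w ≠ 0) (e : ℤ) :
    EuclideanGeometry.Cospherical
        ({vertex m s t 1 2 e, 0, vertex m s t 1 2 (e - s 1), w} : Set ℂ) ↔
      vertex m s t 1 2 e ∈ chord m (shift s) t w 0 0 := by
  have hr : (vertexRadius m s t 2 : ℂ) ≠ 0 := by exact_mod_cast (vertexRadius_pos ht hs 2).ne'
  have hcos := (zcos_natCast_pos (hs 1).2).ne'
  have hsin := (zsin_natCast_pos (hs 1).1 (hs 1).2).ne'
  set g : ℂ := vertexRadius m s t 2 * rot m (2 * e + vertexAngle s t 2 - s 1) with hgdef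
  have hg : g ≠ 0 := mul_ne_zero hr (rot_ne_zero _ _)
  have hleft : vertex m s t 1 2 e = g * rot m (s 1) := by
    rw [vertex, hgdef, one_mul, mul_assoc, ← rot_add, sub_add_cancel]
  have hright : vertex m s t 1 2 (e - s 1) = g * conj (rot m (s 1)) := by
    rw [vertex, hgdef, one_mul, mul_assoc, conj_rot, ← rot_add]
    ring_nf
  have hchord := mem_chord_iff (s := shift s) ht (fun j => hs (j + 1)) hw 0 0
    (vertex m s t 1 2 e)
  have hangle : chordAngle (shift s) t 0 0 = s 1 := by simp [chordAngle, vertexAngle, shift]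
  have hdist : chordDist m (shift s) t 0 = zcos m (s 1) := by
    simp [chordDist, vertexRadius, shift]
  rw [hchord, hangle, hdist, hleft, hright, ← mul_div_cancel₀ w hg,
    cospherical_conj_iff (by rw [Complex.normSq_eq_norm_sq, norm_rot, one_pow])
      (by rwa [rot_re]) (by rwa [rot_im]) hg (div_ne_zero hw hg), mul_div_cancel₀ w hg, inv_div,
    rot_re, rot_neg]
  field_simp [rot_ne_zero]

section

variable {m h : ℕ} [NeZero h] {s t : Fin h → ℕ}

theorem periodicExtension_add_self {α : Type*} (s : Fin h → α) (l : ℕ) :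
    periodicExtension s (l + h) = periodicExtension s l := by
  refine congrArg s (Fin.ext ?_)
  simp

theorem periodicExtension_cyclicShift (s : Fin h → ℕ) :
    periodicExtension (cyclicShift s) = shift (periodicExtension s) :=
  funext fun l => (periodicExtension_succ s l).symm

theorem celestialVertex_eq_vertex (s t : Fin h → ℕ) (z : ℂ) (j : Fin h) (i : ℤ) :
    celestialVertex m s t z j i =
      vertex m (periodicExtension s) (periodicExtension t) z j i := by
  have hrange : Finset.range (j : ℕ) = (Finset.Iio j).map Fin.valEmbedding := by
    rw [Fin.map_valEmbedding_Iio, Nat.Iio_eq_range]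
  simp only [celestialVertex, vertex, vertexRadius, vertexAngle, rot, hrange, Finset.prod_map,
    Finset.sum_map, Fin.valEmbedding_apply, periodicExtension_val, ccos_eq_zcos]
  push_cast
  rfl

theorem celestialLine_eq_chord (s t : Fin h → ℕ) (z : ℂ) (j : Fin h) (i : ℤ) :
    celestialLine m s t z j i = chord m (periodicExtension s) (periodicExtension t) z j i := by
  rw [celestialLine, chord, celestialVertex_eq_vertex, celestialVertex_eq_vertex,
    periodicExtension_val]

variable (hc : IsCelestialCohort m h (Finset.univ.val.map s) (Finset.univ.val.map t))
include hc

theorem periodicExtension_left_range (j : ℕ) :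
    0 < periodicExtension s j ∧ 2 * periodicExtension s j < m :=
  hc.left_range _ (by simp [periodicExtension])

theorem periodicExtension_right_range (j : ℕ) : 2 * periodicExtension t j < m :=
  (hc.right_range _ (by simp [periodicExtension])).2

theorem vertexRadius_periodicExtension_self :
    vertexRadius m (periodicExtension s) (periodicExtension t) h = 1 := by
  have hpos : 0 < ∏ i, zcos m (t i) := Finset.prod_pos fun i _ =>
    zcos_natCast_pos (hc.right_range _ (by simp)).2
  simp only [vertexRadius, Finset.prod_range, periodicExtension_val]
  rw [Finset.prod_div_distrib, hc.prod_zcos_eq, div_self hpos.ne']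

theorem vertexRadius_periodicExtension_add_self (j : ℕ) :
    vertexRadius m (periodicExtension s) (periodicExtension t) (j + h) =
      vertexRadius m (periodicExtension s) (periodicExtension t) j := by
  rw [vertexRadius, add_comm j h, Finset.prod_range_add, ← vertexRadius,
    vertexRadius_periodicExtension_self hc, one_mul]
  simp only [add_comm h, periodicExtension_add_self, vertexRadius]

theorem even_vertexAngle_periodicExtension_self :
    Even (vertexAngle (periodicExtension s) (periodicExtension t) h) := by
  have hsum : Even (∑ i, s i + ∑ i, t i) := hc.even_sum
  simp only [vertexAngle, Finset.sum_range, periodicExtension_val, Finset.sum_sub_distrib]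
  rw [Int.even_sub, ← Int.even_add]
  exact_mod_cast hsum

theorem exists_vertex_add_self_eq : ∃ τ : ℤ, ∀ z j i,
    vertex m (periodicExtension s) (periodicExtension t) z (j + h) i =
      vertex m (periodicExtension s) (periodicExtension t) z j (i + τ) := by
  obtain ⟨τ, hτ⟩ := even_vertexAngle_periodicExtension_self hc
  refine ⟨τ, fun z j i => ?_⟩
  have hangle : vertexAngle (periodicExtension s) (periodicExtension t) (j + h) =
      vertexAngle (periodicExtension s) (periodicExtension t) j + (τ + τ) := by
    rw [vertexAngle, add_comm j h, Finset.sum_range_add, ← vertexAngle, hτ, add_comm]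
    simp only [add_comm h, periodicExtension_add_self, vertexAngle]
  rw [vertex, vertex, vertexRadius_periodicExtension_add_self hc, hangle]
  ring_nf

theorem exists_vertex_eq_celestialVertex (j : ℕ) : ∃ n : ℤ, ∀ z i,
    vertex m (periodicExtension s) (periodicExtension t) z j i =
      celestialVertex m s t z (Fin.ofNat h j) (i + n) := by
  obtain ⟨τ, hτ⟩ := exists_vertex_add_self_eq hc
  have hmul (q r : ℕ) (z : ℂ) (i : ℤ) :
      vertex m (periodicExtension s) (periodicExtension t) z (r + h * q) i =
        vertex m (periodicExtension s) (periodicExtension t) z r (i + q * τ) := by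
    induction q generalizing i with
    | zero => simp
    | succ q ih =>
      rw [mul_add, mul_one, ← add_assoc, hτ, ih]
      push_cast
      ring_nf
  refine ⟨(j / h : ℕ) * τ, fun z i => ?_⟩
  rw [celestialVertex_eq_vertex, ← hmul, Fin.val_ofNat, Nat.mod_add_div]

theorem celestialPoints_eq_vertexSet (z : ℂ) :
    celestialPoints m s t z =
      vertexSet m (periodicExtension s) (periodicExtension t) z := by
  ext p
  constructor
  · rintro ⟨j, i, rfl⟩
    exact ⟨j, i, celestialVertex_eq_vertex s t z j i⟩
  · rintro ⟨j, i, rfl⟩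
    obtain ⟨n, hn⟩ := exists_vertex_eq_celestialVertex hc j
    exact ⟨_, _, hn z i⟩

theorem celestialLines_eq_chordSet (z : ℂ) :
    celestialLines m s t z =
      chordSet m (periodicExtension s) (periodicExtension t) z := by
  ext l
  constructor
  · rintro ⟨j, i, rfl⟩
    exact ⟨j, i, celestialLine_eq_chord s t z j i⟩
  · rintro ⟨j, i, rfl⟩
    obtain ⟨n, hn⟩ := exists_vertex_eq_celestialVertex hc j
    refine ⟨Fin.ofNat h j, i + n, ?_⟩
    rw [chord, celestialLine, hn, hn, periodicExtension, add_right_comm]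

theorem exists_eq_vertex_add_two {z p : ℂ}
    (hp : p ∈ vertexSet m (periodicExtension s) (periodicExtension t) z) :
    ∃ j i, p = vertex m (periodicExtension s) (periodicExtension t) z (j + 2) i := by
  obtain ⟨τ, hτ⟩ := exists_vertex_add_self_eq hc
  obtain ⟨k, i, rfl⟩ := hp
  have hh : 1 ≤ h := NeZero.one_le
  refine ⟨k + h + h - 2, i - τ - τ, ?_⟩
  rw [show k + h + h - 2 + 2 = k + h + h by lia, hτ, hτ, sub_add_cancel, sub_add_cancel]

variable (ht : ∀ j, t (j + 2) = t j)
include ht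

theorem exists_isNestingChoice_iff : ∃ n : ℤ, ∀ d w, IsNestingChoice m s t d w ↔
    ∃ x, w = nestingStart m (periodicExtension s) x ∧
      IsNestingRoot m (t 0) (t 1) (t 0 + t 1 - 2 * (d - n)) x := by
  have hs' := periodicExtension_left_range hc
  have ht' := periodicExtension_right_range hc
  obtain ⟨n, hn⟩ := exists_vertex_eq_celestialVertex hc 2
  have hvertex (i : ℤ) : celestialVertex m s t 1 2 i =
      vertex m (periodicExtension s) (periodicExtension t) 1 2 (i - n) := by
    rw [hn, sub_add_cancel]
    rfl
  refine ⟨n, fun d w => ?_⟩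
  have hcospherical {x : ℝ} (hw : w = nestingStart m (periodicExtension s) x) :
      EuclideanGeometry.Cospherical
          ({celestialVertex m s t 1 2 d, 0, celestialVertex m s t 1 2 (d - s 1), w} : Set ℂ) ↔
        IsNestingRoot m (t 0) (t 1) (t 0 + t 1 - 2 * (d - n)) x := by
    have hmem := vertex_add_two_mem_chord_shift_iff ht' hs' (periodicExtension_add_two ht) x 0 0
      (d - n)
    rw [zero_add, zero_add] at hmem
    rw [hvertex, hvertex, sub_right_comm, hw]
    exact (cospherical_vertex_iff ht' hs' (nestingStart_ne_zero hs' x) _).trans hmem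
  rw [IsNestingChoice, celestialLine_eq_chord, Fin.val_zero, mem_chord_zero_iff ht' hs']
  exact ⟨fun ⟨⟨x, hw⟩, h⟩ => ⟨x, hw, (hcospherical hw).1 h⟩,
    fun ⟨x, hw, h⟩ => ⟨⟨x, hw⟩, (hcospherical hw).2 h⟩⟩

end

section

variable {m : ℕ} {s t : ℕ → ℕ} (ht : ∀ j, 2 * t j < m) (hs : ∀ j, 0 < s j ∧ 2 * s j < m)
include ht hs

theorem exists_mem_chordSet_of_mem_vertexSet_shift {x : ℝ} {p : ℂ}
    (hp : p ∈ vertexSet m (shift s) t (nestingStart m s x)) : ∃ l ∈ chordSet m s t 1, p ∈ l := by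
  obtain ⟨j, i, rfl⟩ := hp
  exact ⟨_, ⟨j, i, rfl⟩, vertex_shift_mem_chord ht hs x j i⟩

theorem exists_mem_vertexSet_shift_of_mem_chordSet (x : ℝ) {l : AffineSubspace ℝ ℂ}
    (hl : l ∈ chordSet m s t 1) :
    ∃ p ∈ vertexSet m (shift s) t (nestingStart m s x), p ∈ l := by
  obtain ⟨j, i, rfl⟩ := hl
  exact ⟨_, ⟨j, i, rfl⟩, vertex_shift_mem_chord ht hs x j i⟩

theorem exists_mem_vertexSet_of_mem_chordSet_shift (ht2 : ∀ j, t (j + 2) = t j) {x : ℝ} {e : ℤ}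
    (hx : IsNestingRoot m (t 0) (t 1) (t 0 + t 1 - 2 * e) x) {l : AffineSubspace ℝ ℂ}
    (hl : l ∈ chordSet m (shift s) t (nestingStart m s x)) :
    ∃ p ∈ vertexSet m s t 1, p ∈ l := by
  obtain ⟨j, i, rfl⟩ := hl
  exact ⟨_, ⟨j + 2, i + e, rfl⟩, (vertex_add_two_mem_chord_shift_iff ht hs ht2 x j i e).2 hx⟩

end

section

variable {m h : ℕ} [NeZero h] {s t : Fin h → ℕ} (ht : ∀ j, t (j + 2) = t j)
include ht

theorem exists_mem_chordSet_shift_of_mem_vertexSet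
    (hc : IsCelestialCohort m h (Finset.univ.val.map s) (Finset.univ.val.map t)) {x : ℝ} {e : ℤ}
    (hx : IsNestingRoot m (t 0) (t 1) (t 0 + t 1 - 2 * e) x) {p : ℂ}
    (hp : p ∈ vertexSet m (periodicExtension s) (periodicExtension t) 1) :
    ∃ l ∈ chordSet m (shift (periodicExtension s)) (periodicExtension t)
      (nestingStart m (periodicExtension s) x), p ∈ l := by
  obtain ⟨j, i, rfl⟩ := exists_eq_vertex_add_two hc hp
  have hmem := (vertex_add_two_mem_chord_shift_iff (periodicExtension_right_range hc)
    (periodicExtension_left_range hc) (periodicExtension_add_two ht) x j (i - e) e).2 hx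
  rw [sub_add_cancel] at hmem
  exact ⟨_, ⟨j, i - e, rfl⟩, hmem⟩

variable (h₁ : IsCelestialConfiguration m s t) (h₂ : IsCelestialConfiguration m (cyclicShift s) t)
include h₁ h₂

theorem isGeometricConfiguration_nesting_of_notMem_rotField {x : ℝ} {e : ℤ}
    (hx : IsNestingRoot m (t 0) (t 1) (t 0 + t 1 - 2 * e) x) (hxK : x * Complex.I ∉ rotField m) :
    IsGeometricConfiguration (2 * (m * h)) 5
      (nestingPoints m s t (nestingStart m (periodicExtension s) x))
      (nestingLines m s t (nestingStart m (periodicExtension s) x)) := by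
  have hs' := periodicExtension_left_range h₁.cohort
  have ht' := periodicExtension_right_range h₁.cohort
  have ht2 := periodicExtension_add_two ht
  refine h₁.configuration.union_of_existsUnique (by norm_num)
    (h₂.configuration.celestial_of_ne_zero one_ne_zero (nestingStart_ne_zero hs' x)) ?_ ?_ ?_ ?_ <;>
  simp only [celestialPoints_eq_vertexSet h₁.cohort, celestialLines_eq_chordSet h₁.cohort,
    celestialPoints_eq_vertexSet h₂.cohort, celestialLines_eq_chordSet h₂.cohort,
    periodicExtension_cyclicShift]
  · exact fun p hp => existsUnique_mem_chordSet_shift ht' hs' hxK hx hp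
      (exists_mem_chordSet_shift_of_mem_vertexSet ht h₁.cohort hx hp)
  · exact fun p hp => existsUnique_mem_chordSet ht' hs' hxK hp
  · exact fun l hl => exists_mem_vertexSet_shift_of_mem_chordSet ht' hs' x hl
  · exact fun l hl => exists_mem_vertexSet_of_mem_chordSet_shift ht' hs' ht2 hx hl

theorem isGeometricConfiguration_nesting_of_ncard_le {x : ℝ} {e : ℤ}
    (hx : IsNestingRoot m (t 0) (t 1) (t 0 + t 1 - 2 * e) x) {w : ℂ}
    (hw : w = nestingStart m (periodicExtension s) x)
    (hP : (nestingPoints m s t w).ncard = 2 * (m * h))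
    (hL : (nestingLines m s t w).ncard = 2 * (m * h))
    (hle : ∀ p ∈ nestingPoints m s t w, {l | l ∈ nestingLines m s t w ∧ p ∈ l}.ncard ≤ 5) :
    IsGeometricConfiguration (2 * (m * h)) 5 (nestingPoints m s t w) (nestingLines m s t w) := by
  have hs' := periodicExtension_left_range h₁.cohort
  have ht' := periodicExtension_right_range h₁.cohort
  have ht2 := periodicExtension_add_two ht
  refine h₁.configuration.union_of_ncard_le
    (h₂.configuration.celestial_of_ne_zero one_ne_zero (hw ▸ nestingStart_ne_zero hs' x)) hP hL hle
    ?_ ?_ ?_ ?_ <;>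
  simp only [celestialPoints_eq_vertexSet h₁.cohort, celestialLines_eq_chordSet h₁.cohort,
    celestialPoints_eq_vertexSet h₂.cohort, celestialLines_eq_chordSet h₂.cohort,
    periodicExtension_cyclicShift, hw]
  · exact fun p hp => exists_mem_chordSet_shift_of_mem_vertexSet ht h₁.cohort hx hp
  · exact fun p hp => exists_mem_chordSet_of_mem_vertexSet_shift ht' hs' hp
  · exact fun l hl => exists_mem_vertexSet_shift_of_mem_chordSet ht' hs' x hl
  · exact fun l hl => exists_mem_vertexSet_of_mem_chordSet_shift ht' hs' ht2 hx hl

theorem nestingProduces_of_alternating (hst : ∀ i j, s i ≠ t j) :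
    NestingProduces (2 * m * h) m s t := by
  rw [mul_assoc]
  obtain ⟨n, hn⟩ := exists_isNestingChoice_iff h₁.cohort ht
  constructor
  · obtain ⟨ψ, x, ⟨q, hq⟩, hxK, hx⟩ := exists_root_notMem_rotField_of_cohort h₁.cohort hst ht
    obtain rfl : ψ = t 0 + t 1 - 2 * (n - q - n) := by linear_combination hq
    exact ⟨n - q, _, (hn _ _).2 ⟨x, rfl, hx⟩,
      isGeometricConfiguration_nesting_of_notMem_rotField ht h₁ h₂ hx hxK⟩
  · intro d w hdw hP hL hle
    obtain ⟨x, hw, hx⟩ := (hn d w).1 hdw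
    exact isGeometricConfiguration_nesting_of_ncard_le ht h₁ h₂ hx hw hP hL hle

end

section

variable {m : ℕ} {s t : ℕ → ℕ}

theorem vertex_shift_vertex_one (z : ℂ) (j : ℕ) (i : ℤ) :
    vertex m (shift s) (shift t) (vertex m s t z 1 0) j i = vertex m s t z (j + 1) i := by
  have hradius : vertexRadius m s t (j + 1) =
      vertexRadius m s t 1 * vertexRadius m (shift s) (shift t) j := by
    simp only [vertexRadius, shift, Finset.prod_range_succ', Finset.prod_range_zero, one_mul]
    exact mul_comm _ _
  have hangle : vertexAngle s t (j + 1) =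
      vertexAngle s t 1 + vertexAngle (shift s) (shift t) j := by
    simp only [vertexAngle, shift, Finset.sum_range_succ', Finset.sum_range_zero, zero_add]
    exact add_comm _ _
  rw [vertex, vertex, vertex, hradius, hangle, mul_zero, zero_add, add_left_comm,
    rot_add m (vertexAngle s t 1)]
  push_cast
  ring

theorem chord_shift_vertex_one (z : ℂ) (j : ℕ) (i : ℤ) :
    chord m (shift s) (shift t) (vertex m s t z 1 0) j i = chord m s t z (j + 1) i := by
  rw [chord, chord, vertex_shift_vertex_one, vertex_shift_vertex_one, shift]

theorem vertexSet_shift_vertex_one {z : ℂ} {h : ℕ} [NeZero h] {τ : ℤ}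
    (hτ : ∀ j i, vertex m s t z (j + h) i = vertex m s t z j (i + τ)) :
    vertexSet m (shift s) (shift t) (vertex m s t z 1 0) = vertexSet m s t z := by
  have hh : 1 ≤ h := NeZero.one_le
  ext p
  constructor
  · rintro ⟨j, i, rfl⟩
    exact ⟨j + 1, i, vertex_shift_vertex_one z j i⟩
  · rintro ⟨j, i, rfl⟩
    refine ⟨j + h - 1, i - τ, ?_⟩
    rw [vertex_shift_vertex_one, show j + h - 1 + 1 = j + h by lia, hτ, sub_add_cancel]

theorem chordSet_shift_vertex_one {z : ℂ} {h : ℕ} [NeZero h] {τ : ℤ}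
    (hτ : ∀ j i, chord m s t z (j + h) i = chord m s t z j (i + τ)) :
    chordSet m (shift s) (shift t) (vertex m s t z 1 0) = chordSet m s t z := by
  have hh : 1 ≤ h := NeZero.one_le
  ext l
  constructor
  · rintro ⟨j, i, rfl⟩
    exact ⟨j + 1, i, chord_shift_vertex_one z j i⟩
  · rintro ⟨j, i, rfl⟩
    refine ⟨j + h - 1, i - τ, ?_⟩
    rw [chord_shift_vertex_one, show j + h - 1 + 1 = j + h by lia, hτ, sub_add_cancel]

end

section

variable {m h : ℕ} [NeZero h]

theorem map_univ_cyclicShift (f : Fin h → ℕ) :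
    Finset.univ.val.map (cyclicShift f) = Finset.univ.val.map f := by
  conv_rhs => rw [← Multiset.map_univ_val_equiv (Equiv.addRight (1 : Fin h)), Multiset.map_map]
  rfl

theorem isCelestialConfiguration_cyclicShift {s t : Fin h → ℕ}
    (hc : IsCelestialConfiguration m s t) :
    IsCelestialConfiguration m (cyclicShift s) (cyclicShift t) := by
  have hcohort : IsCelestialCohort m h (Finset.univ.val.map (cyclicShift s))
      (Finset.univ.val.map (cyclicShift t)) := by
    rw [map_univ_cyclicShift, map_univ_cyclicShift]
    exact hc.cohort
  have hs := periodicExtension_left_range hc.cohort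
  have ht := periodicExtension_right_range hc.cohort
  obtain ⟨τ, hτ⟩ := exists_vertex_add_self_eq hc.cohort
  have hτ' (j i) : chord m (periodicExtension s) (periodicExtension t) 1 (j + h) i =
      chord m (periodicExtension s) (periodicExtension t) 1 j (i + τ) := by
    rw [chord, chord, hτ, hτ, periodicExtension_add_self, add_right_comm]
  have hz : vertex m (periodicExtension s) (periodicExtension t) 1 1 0 ≠ 0 :=
    mul_ne_zero (by simpa using (vertexRadius_pos ht hs 1).ne') (rot_ne_zero _ _)
  refine ⟨hcohort, IsGeometricConfiguration.celestial_of_ne_zero ?_ hz one_ne_zero⟩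
  rw [celestialPoints_eq_vertexSet hcohort, celestialLines_eq_chordSet hcohort,
    periodicExtension_cyclicShift, periodicExtension_cyclicShift,
    vertexSet_shift_vertex_one (hτ 1), chordSet_shift_vertex_one hτ',
    ← celestialPoints_eq_vertexSet hc.cohort, ← celestialLines_eq_chordSet hc.cohort]
  exact hc.configuration

end

section

variable {ι κ : Type*} [Fintype ι] [Fintype κ]

theorem IsGeometricConfiguration.of_incidence {P : ι → ℂ} {L : κ → AffineSubspace ℝ ℂ}
    {R : ι → κ → Prop} [DecidableRel R] {n k : ℕ} (hR : ∀ a b, P a ∈ L b ↔ R a b)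
    (hisLine : ∀ b, Module.finrank ℝ (L b).direction = 1)
    (hι : Fintype.card ι = n) (hκ : Fintype.card κ = n)
    (hpoint : ∀ a a', (∀ b, R a b ↔ R a' b) → a = a')
    (hline : ∀ b b', (∀ a, R a b ↔ R a b') → b = b')
    (hcard_line : ∀ b, (Finset.univ.filter fun a => R a b).card = k)
    (hcard_point : ∀ a, (Finset.univ.filter fun b => R a b).card = k) :
    IsGeometricConfiguration n k (Set.range P) (Set.range L) := by
  have hP : Function.Injective P := fun a a' h => hpoint a a' fun b => by rw [← hR, ← hR, h]
  have hL : Function.Injective L := fun b b' h => hline b b' fun a => by rw [← hR, ← hR, h]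
  refine ⟨Set.finite_range P, Set.finite_range L, ?_, ?_, Set.forall_mem_range.2 hisLine,
    Set.forall_mem_range.2 fun b => ?_, Set.forall_mem_range.2 fun a => ?_⟩
  · rw [Set.ncard_range_of_injective hP, Nat.card_eq_fintype_card, hι]
  · rw [Set.ncard_range_of_injective hL, Nat.card_eq_fintype_card, hκ]
  · rw [← Set.image_univ, ncard_sep_image hP, ← hcard_line b, ← Set.ncard_coe_finset]
    simp [hR]
  · rw [← Set.image_univ, ncard_sep_image hL, ← hcard_point a, ← Set.ncard_coe_finset]
    simp [hR]

end

section

variable {m : ℕ} {s t : ℕ → ℕ}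

theorem rot_eq_of_modEq (hm : 0 < m) {M N : ℤ} (h : M ≡ N [ZMOD 2 * m]) : rot m M = rot m N := by
  obtain ⟨k, hk⟩ := h.symm.dvd
  have hroot : rot m 1 ^ (2 * m : ℤ) = 1 := by
    exact_mod_cast (isPrimitiveRoot_rot_one hm).pow_eq_one
  rw [eq_add_of_sub_eq hk, rot_add, rot_mul, rot_eq_zpow, hroot, one_zpow, one_mul]

theorem vertex_eq_of_modEq (hm : 0 < m) (z : ℂ) (j : ℕ) {i l : ℤ} (h : i ≡ l [ZMOD m]) :
    vertex m s t z j i = vertex m s t z j l := by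
  rw [vertex, vertex, rot_eq_of_modEq hm ((h.mul_left' (c := 2)).add_right _)]

theorem chord_eq_of_modEq (hm : 0 < m) (z : ℂ) (j : ℕ) {i l : ℤ} (h : i ≡ l [ZMOD m]) :
    chord m s t z j i = chord m s t z j l := by
  rw [chord, chord, vertex_eq_of_modEq hm z j h, vertex_eq_of_modEq hm z j (h.add_right _)]

variable (ht : ∀ j, 2 * t j < m) (hs : ∀ j, 0 < s j ∧ 2 * s j < m)
include ht hs

theorem vertex_mem_chord_iff {z : ℂ} (hz : z ≠ 0) (j k : ℕ) (i l : ℤ) :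
    vertex m s t z k i ∈ chord m s t z j l ↔
      vertexRadius m s t k * zcos m (2 * i + vertexAngle s t k - chordAngle s t j l) =
        chordDist m s t j := by
  have hrot : rot m (-chordAngle s t j l) * (vertex m s t z k i / z) =
      vertexRadius m s t k * rot m (2 * i + vertexAngle s t k - chordAngle s t j l) := by
    rw [vertex, sub_eq_neg_add, rot_add m (-_)]
    field_simp
  rw [mem_chord_iff ht hs hz, hrot, Complex.re_ofReal_mul, rot_re]

theorem finrank_direction_chord {z : ℂ} (hz : z ≠ 0) (j : ℕ) (i : ℤ) :
    Module.finrank ℝ (chord m s t z j i).direction = 1 := by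
  rw [chord, direction_affineSpan, vectorSpan_pair]
  refine finrank_span_singleton (vsub_ne_zero.2 fun h => ?_)
  have hradius : (vertexRadius m s t j : ℂ) ≠ 0 := by
    exact_mod_cast (vertexRadius_pos ht hs j).ne'
  rw [vertex, vertex, mul_right_inj' (mul_ne_zero hz hradius), mul_add, add_right_comm,
    rot_add m (2 * i + _), left_eq_mul₀ (rot_ne_zero _ _)] at h
  have hcos : zcos m (2 * s j) ^ 2 = 1 := by rw [← rot_re, h, Complex.one_re, one_pow]
  obtain ⟨h0, hsm⟩ := hs j
  have := Int.le_of_dvd (by lia) ((zcos_sq_eq_one_iff (by lia)).1 hcos)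
  lia

end

section

variable {m h : ℕ} [NeZero m]

theorem exists_fin_modEq (i : ℤ) : ∃ r : Fin m, i ≡ (r : ℕ) [ZMOD m] := by
  have hm : (0 : ℤ) < m := mod_cast Nat.pos_of_neZero m
  have h0 := Int.emod_nonneg i hm.ne'
  refine ⟨⟨(i % m).toNat, by have := Int.emod_lt_of_pos i hm; lia⟩, ?_⟩
  rw [Int.toNat_of_nonneg h0]
  exact (Int.mod_modEq i m).symm

variable [NeZero h] {s t : Fin h → ℕ}

theorem celestialPoints_eq_range (s t : Fin h → ℕ) (z : ℂ) :
    celestialPoints m s t z = Set.range fun a : Fin h × Fin m =>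
      vertex m (periodicExtension s) (periodicExtension t) z a.1 (a.2 : ℕ) := by
  ext p
  constructor
  · rintro ⟨j, i, rfl⟩
    obtain ⟨r, hr⟩ := exists_fin_modEq (m := m) i
    refine ⟨(j, r), ?_⟩
    rw [celestialVertex_eq_vertex, vertex_eq_of_modEq (Nat.pos_of_neZero m) z j hr]
  · rintro ⟨⟨j, r⟩, rfl⟩
    exact ⟨j, (r : ℕ), (celestialVertex_eq_vertex s t z j r).symm⟩

theorem celestialLines_eq_range (s t : Fin h → ℕ) (z : ℂ) :
    celestialLines m s t z = Set.range fun b : Fin h × Fin m =>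
      chord m (periodicExtension s) (periodicExtension t) z b.1 (b.2 : ℕ) := by
  ext l
  constructor
  · rintro ⟨j, i, rfl⟩
    obtain ⟨r, hr⟩ := exists_fin_modEq (m := m) i
    refine ⟨(j, r), ?_⟩
    rw [celestialLine_eq_chord, chord_eq_of_modEq (Nat.pos_of_neZero m) z j hr]
  · rintro ⟨⟨j, r⟩, rfl⟩
    exact ⟨j, (r : ℕ), (celestialLine_eq_chord s t z j r).symm⟩

theorem isCelestialConfiguration_of_incidence
    (hc : IsCelestialCohort m h (Finset.univ.val.map s) (Finset.univ.val.map t))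
    {R : Fin h × Fin m → Fin h × Fin m → Prop} [DecidableRel R]
    (hR : ∀ a b, vertex m (periodicExtension s) (periodicExtension t) 1 a.1 (a.2 : ℕ) ∈
      chord m (periodicExtension s) (periodicExtension t) 1 b.1 (b.2 : ℕ) ↔ R a b)
    (hpoint : ∀ a a', (∀ b, R a b ↔ R a' b) → a = a')
    (hline : ∀ b b', (∀ a, R a b ↔ R a b') → b = b')
    (hcard_line : ∀ b, (Finset.univ.filter fun a => R a b).card = 4)
    (hcard_point : ∀ a, (Finset.univ.filter fun b => R a b).card = 4) :
    IsCelestialConfiguration m s t := by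
  have hcard : Fintype.card (Fin h × Fin m) = m * h := by simp [mul_comm]
  refine ⟨hc, ?_⟩
  rw [celestialPoints_eq_range, celestialLines_eq_range]
  exact .of_incidence hR (fun _ => finrank_direction_chord (periodicExtension_right_range hc)
    (periodicExtension_left_range hc) one_ne_zero _ _) hcard hcard hpoint hline hcard_line
    hcard_point

end

theorem zcos_nine_three : zcos 9 3 = 1 / 2 := by
  rw [zcos, ← Real.cos_pi_div_three]
  congr 1
  push_cast
  ring

theorem two_mul_zcos_nine_one_mul_two : 2 * zcos 9 1 * zcos 9 2 = zcos 9 1 + 1 / 2 := by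
  rw [two_mul_zcos_mul_zcos, ← zcos_nine_three]
  norm_num [add_comm]

theorem two_mul_zcos_nine_one_mul_four : 2 * zcos 9 1 * zcos 9 4 = 1 / 2 - zcos 9 4 := by
  have h5 : zcos 9 5 = -zcos 9 4 := zcos_sub_self (by lia) 4
  rw [two_mul_zcos_mul_zcos, ← zcos_nine_three]
  norm_num
  rw [h5]
  ring

theorem two_mul_zcos_nine_two_mul_four : 2 * zcos 9 2 * zcos 9 4 = zcos 9 2 - 1 / 2 := by
  have h6 : zcos 9 6 = -zcos 9 3 := zcos_sub_self (by lia) 3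
  rw [two_mul_zcos_mul_zcos, ← zcos_nine_three]
  norm_num
  rw [h6]
  ring

theorem zcos_nine_four_mul_two_mul_one : zcos 9 4 * zcos 9 2 * zcos 9 1 = 1 / 8 := by
  linear_combination zcos 9 4 / 2 * two_mul_zcos_nine_one_mul_two +
    two_mul_zcos_nine_one_mul_four / 4

theorem half_lt_zcos_nine {N : ℤ} (h0 : 0 ≤ N) (h3 : N < 3) : 1 / 2 < zcos 9 N := by
  rw [← zcos_nine_three]
  exact strictAntiOn_zcos (by lia) ⟨h0, by lia⟩ (by norm_num) h3

theorem zcos_nine_ne {v : ℝ} (h4 : zcos 9 4 < v) (h3 : v < 1 / 2) (N : ℤ) : zcos 9 N ≠ v := by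
  have hanti := (strictAntiOn_zcos (m := 9) (by lia)).antitoneOn
  obtain ⟨n, ⟨hn0, hn9⟩, -, hn⟩ := exists_zcos_eq (m := 9) (by lia) N
  rw [← hn]
  rcases le_or_gt n 3 with hle | hlt
  · have := hanti ⟨hn0, hn9⟩ (by norm_num) hle
    rw [zcos_nine_three] at this
    linarith
  · have := hanti (a := 4) (by norm_num) ⟨hn0, hn9⟩ hlt
    linarith

theorem isCelestialCohort_nine : IsCelestialCohort 9 3
    (Finset.univ.val.map ![4, 2, 1]) (Finset.univ.val.map ![3, 3, 3]) := by
  refine ⟨rfl, rfl, by decide, by decide, by decide, ?_⟩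
  change ∏ i, ccos 9 (![4, 2, 1] i) = ∏ i, ccos 9 (![3, 3, 3] i)
  simp only [Fin.prod_univ_three, ccos_eq_zcos]
  change zcos 9 4 * zcos 9 2 * zcos 9 1 = zcos 9 3 * zcos 9 3 * zcos 9 3
  rw [zcos_nine_four_mul_two_mul_one, zcos_nine_three]
  norm_num

theorem vertexRadius_nine (k : Fin 3) :
    vertexRadius 9 (periodicExtension ![4, 2, 1]) (periodicExtension ![3, 3, 3]) k =
      ![1, 2 * zcos 9 4, 4 * zcos 9 4 * zcos 9 2] k := by
  have h₁ : vertexRadius 9 (periodicExtension ![4, 2, 1]) (periodicExtension ![3, 3, 3]) 1 =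
      2 * zcos 9 4 := by
    rw [vertexRadius, Finset.prod_range_one]
    change zcos 9 4 / zcos 9 3 = _
    rw [zcos_nine_three]
    ring
  have h₂ : vertexRadius 9 (periodicExtension ![4, 2, 1]) (periodicExtension ![3, 3, 3]) 2 =
      4 * zcos 9 4 * zcos 9 2 := by
    rw [vertexRadius_succ, h₁]
    change 2 * zcos 9 4 * (zcos 9 2 / zcos 9 3) = _
    rw [zcos_nine_three]
    ring
  fin_cases k
  exacts [rfl, h₁, h₂]

theorem chordDist_nine (j : Fin 3) :
    chordDist 9 (periodicExtension ![4, 2, 1]) (periodicExtension ![3, 3, 3]) j =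
      ![zcos 9 4, 2 * zcos 9 4 * zcos 9 2, 1 / 2] j := by
  rw [chordDist, vertexRadius_nine, periodicExtension_val]
  fin_cases j <;> norm_num
  linear_combination 4 * zcos_nine_four_mul_two_mul_one

/-- The incidences of `9#(4,3;2,3;1,3)`: the first component of an index is the class. The lines of
class `2` meet the points of class `0 = 2 + 1` with a shift of the index by one, as the vertex class
`v_3` is `v_0` turned by the angle `(4 + 2 + 1 - 3 - 3 - 3) π / 9 = -2π / 9`. -/
def IsNineIncident (a b : Fin 3 × Fin 9) : Prop :=
  a.1 = b.1 ∧ (a.2 = b.2 ∨ a.2 = b.2 + ![4, 2, 1] b.1) ∨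
    a.1 = b.1 + 1 ∧ (a.2 + ![0, 0, 1] b.1 = b.2 ∨ a.2 + ![0, 0, 1] b.1 = b.2 + 3)

instance : DecidableRel IsNineIncident := fun _ _ => inferInstanceAs (Decidable (_ ∨ _))

theorem mul_eq_iff_of_fin_three {R : Type*} [MulZeroClass R] [IsLeftCancelMulZero R]
    {r d c : Fin 3 → R} {x e : R} (hr : ∀ k, r k ≠ 0) (hd₀ : ∀ j, d j = r j * c j)
    (hd₁ : ∀ j, d j = r (j + 1) * e) (hd₂ : ∀ j, r (j + 2) * x ≠ d j) (k j : Fin 3) :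
    r k * x = d j ↔ k = j ∧ x = c j ∨ k = j + 1 ∧ x = e := by
  obtain rfl | rfl | rfl : k = j ∨ k = j + 1 ∨ k = j + 2 := by decide +revert
  · have : k ≠ k + 1 := by decide +revert
    simp [this, hd₀, hr]
  · have : j + 1 ≠ j := by decide +revert
    simp [this, hd₁, hr]
  · have h₀ : j + 2 ≠ j := by decide +revert
    have h₁ : j + 2 ≠ j + 1 := by decide +revert
    simp [h₀, h₁, hd₂]

theorem vertexRadius_nine_mul_zcos_eq_chordDist_iff (k j : Fin 3) (N : ℤ) :
    vertexRadius 9 (periodicExtension ![4, 2, 1]) (periodicExtension ![3, 3, 3]) k * zcos 9 N =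
        chordDist 9 (periodicExtension ![4, 2, 1]) (periodicExtension ![3, 3, 3]) j ↔
      k = j ∧ zcos 9 N = zcos 9 (![4, 2, 1] j) ∨ k = j + 1 ∧ zcos 9 N = zcos 9 3 := by
  have h4 : 0 < zcos 9 4 := zcos_pos (by lia) (by lia) (by lia)
  have h2 := half_lt_zcos_nine (N := 2) (by lia) (by lia)
  have h1 := half_lt_zcos_nine (N := 1) (by lia) (by lia)
  have hN := zcos_le_one 9 N
  have h12 := two_mul_zcos_nine_one_mul_two
  have h14 := two_mul_zcos_nine_one_mul_four
  have h24 := two_mul_zcos_nine_two_mul_four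
  have hprod := zcos_nine_four_mul_two_mul_one
  have hne₀ : 4 * zcos 9 4 * zcos 9 2 * zcos 9 N ≠ zcos 9 4 := fun h =>
    zcos_nine_ne (v := 2 * zcos 9 1 * zcos 9 4) (by nlinarith) (by linarith) N <| by
      linear_combination 2 * zcos 9 1 * h - 8 * zcos 9 N * hprod
  have hne₁ : zcos 9 N ≠ 2 * zcos 9 4 * zcos 9 2 := zcos_nine_ne (by nlinarith) (by nlinarith) N
  have hne₂ : 2 * zcos 9 4 * zcos 9 N ≠ 1 / 2 := by nlinarith
  rw [vertexRadius_nine, chordDist_nine, zcos_nine_three]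
  refine mul_eq_iff_of_fin_three (c := fun j => zcos 9 (![4, 2, 1] j)) ?_ ?_ ?_ ?_ k j <;> intro j
  · fin_cases j <;> simp [h4.ne', (one_half_pos.trans h2).ne']
  · fin_cases j <;> simp
    linear_combination -4 * hprod
  · fin_cases j <;> simp <;> ring
  · fin_cases j <;> simpa [← one_div]

theorem vertex_mem_chord_nine_iff (a b : Fin 3 × Fin 9) :
    vertex 9 (periodicExtension ![4, 2, 1]) (periodicExtension ![3, 3, 3]) 1 a.1 (a.2 : ℕ) ∈
      chord 9 (periodicExtension ![4, 2, 1]) (periodicExtension ![3, 3, 3]) 1 b.1 (b.2 : ℕ) ↔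
    IsNineIncident a b := by
  have hs := periodicExtension_left_range isCelestialCohort_nine
  have ht := periodicExtension_right_range isCelestialCohort_nine
  obtain ⟨k, i⟩ := a
  obtain ⟨j, l⟩ := b
  have hangle (k : Fin 3) :
      vertexAngle (periodicExtension ![4, 2, 1]) (periodicExtension ![3, 3, 3]) k =
        ![0, 1, 0] k := by
    fin_cases k <;> rfl
  rw [vertex_mem_chord_iff ht hs one_ne_zero, vertexRadius_nine_mul_zcos_eq_chordDist_iff,
    zcos_eq_zcos_iff (by lia), zcos_eq_zcos_iff (by lia), chordAngle, hangle, hangle,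
    periodicExtension_val, IsNineIncident]
  have := i.2
  have := l.2
  fin_cases k <;> fin_cases j <;> simp [Fin.ext_iff, Fin.val_add] <;> lia

theorem isCelestialConfiguration_nine : IsCelestialConfiguration 9 ![4, 2, 1] ![3, 3, 3] :=
  isCelestialConfiguration_of_incidence isCelestialCohort_nine vertex_mem_chord_nine_iff
    (by decide +kernel) (by decide +kernel) (by decide +kernel) (by decide +kernel)

theorem cyclicShift_vecThree (a b c : ℕ) : cyclicShift ![a, b, c] = ![b, c, a] := by
  funext j
  fin_cases j <;> rfl

theorem cyclicShift_vecFour (a b c d : ℕ) : cyclicShift ![a, b, c, d] = ![b, c, d, a] := by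
  funext j
  fin_cases j <;> rfl

theorem nestingProduces_three {m s₁ s₂ s₃ a : ℕ} (ha₁ : a ≠ s₁) (ha₂ : a ≠ s₂) (ha₃ : a ≠ s₃)
    (h₁ : IsCelestialConfiguration m ![s₁, s₂, s₃] ![a, a, a])
    (h₂ : IsCelestialConfiguration m ![s₂, s₃, s₁] ![a, a, a]) :
    NestingProduces (6 * m) m ![s₁, s₂, s₃] ![a, a, a] := by
  rw [← cyclicShift_vecThree] at h₂
  rw [show 6 * m = 2 * m * 3 by ring]
  refine nestingProduces_of_alternating (fun j => ?_) h₁ h₂ fun i j => ?_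
  · fin_cases j <;> rfl
  · fin_cases i <;> fin_cases j <;> simp [ha₁.symm, ha₂.symm, ha₃.symm]

theorem nestingProduces_four {m s₁ s₂ s₃ s₄ a b : ℕ}
    (hab : ∀ x ∈ [s₁, s₂, s₃, s₄], x ≠ a ∧ x ≠ b)
    (h₁ : IsCelestialConfiguration m ![s₁, s₂, s₃, s₄] ![a, b, a, b])
    (h₂ : IsCelestialConfiguration m ![s₂, s₃, s₄, s₁] ![a, b, a, b]) :
    NestingProduces (8 * m) m ![s₁, s₂, s₃, s₄] ![a, b, a, b] := by
  simp only [List.mem_cons, List.not_mem_nil, or_false, forall_eq_or_imp, forall_eq] at hab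
  rw [← cyclicShift_vecFour] at h₂
  rw [show 8 * m = 2 * m * 4 by ring]
  refine nestingProduces_of_alternating (fun j => ?_) h₁ h₂ fun i j => ?_
  · fin_cases j <;> rfl
  · fin_cases i <;> fin_cases j <;> simp [hab]

theorem isCelestialConfiguration_nine_cyclicShift :
    IsCelestialConfiguration 9 ![2, 1, 4] ![3, 3, 3] := by
  simpa only [cyclicShift_vecThree] using
    isCelestialConfiguration_cyclicShift isCelestialConfiguration_nine

theorem mainTheorem11 :
    (∀ (m h : ℕ) [NeZero h] (S T : Multiset ℕ), IsCelestialCohort m h S T →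
      (∀ x ∈ S, x ∉ T) →
      (Odd h → ∃ a : ℕ, T = Multiset.replicate h a) →
      (Even h → ∃ a b : ℕ, T = Multiset.replicate (h / 2) a + Multiset.replicate (h / 2) b) →
      ∀ s t : Fin h → ℕ, Finset.univ.val.map s = S → Finset.univ.val.map t = T →
        (∀ j, t (j + 2) = t j) →
        IsCelestialConfiguration m s t → IsCelestialConfiguration m (cyclicShift s) t →
        NestingProduces (2 * m * h) m s t) ∧
    (∀ m s₁ s₂ s₃ a : ℕ, a ≠ s₁ → a ≠ s₂ → a ≠ s₃ →
      IsCelestialConfiguration m ![s₁, s₂, s₃] ![a, a, a] →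
      IsCelestialConfiguration m ![s₂, s₃, s₁] ![a, a, a] →
      NestingProduces (6 * m) m ![s₁, s₂, s₃] ![a, a, a]) ∧
    (∀ m s₁ s₂ s₃ s₄ a b : ℕ, (∀ x ∈ [s₁, s₂, s₃, s₄], x ≠ a ∧ x ≠ b) →
      IsCelestialConfiguration m ![s₁, s₂, s₃, s₄] ![a, b, a, b] →
      IsCelestialConfiguration m ![s₂, s₃, s₄, s₁] ![a, b, a, b] →
      NestingProduces (8 * m) m ![s₁, s₂, s₃, s₄] ![a, b, a, b]) ∧
    (IsCelestialConfiguration 9 ![4, 2, 1] ![3, 3, 3] ∧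
      IsCelestialConfiguration 9 ![2, 1, 4] ![3, 3, 3] ∧
      NestingProduces 54 9 ![4, 2, 1] ![3, 3, 3]) := by
  have h₉ := isCelestialConfiguration_nine
  have h₉' := isCelestialConfiguration_nine_cyclicShift
  refine ⟨?_, fun _ _ _ _ _ => nestingProduces_three, fun _ _ _ _ _ _ _ => nestingProduces_four,
    h₉, h₉', nestingProduces_three (by lia) (by lia) (by lia) h₉ h₉'⟩
  rintro m h _ S T - hST - - s t rfl rfl ht h₁ h₂
  refine nestingProduces_of_alternating ht h₁ h₂ fun i j hij => ?_
  exact hST (s i) (Multiset.mem_map_of_mem s (Finset.mem_univ_val i))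
    (hij ▸ Multiset.mem_map_of_mem t (Finset.mem_univ_val j))
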